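/- Fix $k\ge 0$. A $k$-colored linear ordering is a linear ordering (possibly empty) each of whose points has exactly one of $k$ colors, viewed as a structure with a binary relation $<$ and $k$ unary color predicates. It is homogeneous if every isomorphism between finite (equivalently, finitely generated) substructures extends to an automorphism. Let $L(k)$ be the number of countable homogeneous $k$-colored linear orderings, up to isomorphism. Let $W$ be the principal branch of the product logarithm (the inverse of $w\mapsto we^w$ on $[-1,\infty)$). Then: 1. $L(k)$ is finite and equals the number (also finite), up to isomorphism, of linear orderings $(A,<)$ with unary predicates $R_1,\dots,R_k,S_1,\dots,S_k$ such that every point satisfies some $R_i$ or some $S_i$; no point satisfies two different $R_i$, and no point satisfies both some $R_i$ and some $S_j$; each $R_i$ and each $S_i$ holds of at most one point; and for each $i$, $R_i$ and $S_i$ do not both occur in $A$. 2. Let $J(0)=1$ and $J(k+1)=2(k+1)J(k)+\sum_{i=2}^{k+1}\binom{k+1}{i}J(k+1-i)$. Then $L(k)=\sum_{i=0}^{k}J(i)\binom{k}{i}$. 3. The exponential generating function of $L$ is $\sum_{k\ge 0}L(k)\frac{x^k}{k!}=H(x)=\frac{e^x}{2-x-e^x}$. 4. Put $Z=2-W(e^2)\approx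 0.442854$ and $R=\frac{-e^2}{e^{W(e^2)}+e^2}\approx -0.6089389$. Then $\lim_{z\to Z}(z-Z)H(z)=R$, so that $R$ is the residue of $H$ at its simple pole $Z$, and $L(k)\sim -k!\,R\,\left(\frac1Z\right)^{k+1}$ as $k\to\infty$. 5. As $k\to\infty$, the proportion of countable homogeneous $k$-colored linear orderings (up to isomorphism) in which all $k$ colors occur tends to $\frac{1}{W(e^2)}\approx 0.6422007$. Here $\approx$ means: with error less than $10^{-6}$ for $Z$ and less than $10^{-7}$ for $R$ and $1/W(e^2)$. -/

import Mathlib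

open FirstOrder.Language CategoryTheory Filter Topology
open scoped Nat

/-- Relation symbols of `k`-colored orderings: a binary `<` and `k` unary color predicates. -/
inductive ColoredOrderRel (k : ℕ) : ℕ → Type
  | lt : ColoredOrderRel k 2
  | color (i : Fin k) : ColoredOrderRel k 1

/-- The relational language of `k`-colored orderings. -/
def coloredOrderLang (k : ℕ) : FirstOrder.Language.{0, 0} := ⟨fun _ => Empty, ColoredOrderRel k⟩

/-- The structure `M` is a linear ordering in which every point has exactly one of the
`k` colors. -/
structure IsColoredLinearOrder (k : ℕ) (M : Type) [(coloredOrderLang k).Structure M] : Prop where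
  linear : IsStrictTotalOrder M fun x y =>
    Structure.RelMap (L := coloredOrderLang k) ColoredOrderRel.lt ![x, y]
  color : ∀ x : M, ∃! i : Fin k,
    Structure.RelMap (L := coloredOrderLang k) (ColoredOrderRel.color i) ![x]

/-- The countable homogeneous `k`-colored linear orderings (the empty one is allowed). -/
def homogeneousColoredOrders (k : ℕ) : Set (Bundled.{0} (coloredOrderLang k).Structure) :=
  {M | Countable M ∧ IsColoredLinearOrder k M ∧ (coloredOrderLang k).IsUltrahomogeneous M}

/-- The countable homogeneous `k`-colored linear orderings in which every color occurs. -/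
def homogeneousAllColors (k : ℕ) : Set (Bundled.{0} (coloredOrderLang k).Structure) :=
  {M | M ∈ homogeneousColoredOrders k ∧ ∀ i : Fin k, ∃ x : M,
    Structure.RelMap (L := coloredOrderLang k) (ColoredOrderRel.color i) ![x]}

/-- Relation symbols of multicolored orderings: a binary `<` and unary `R i`, `S i`. -/
inductive MultiColoredRel (k : ℕ) : ℕ → Type
  | lt : MultiColoredRel k 2
  | R (i : Fin k) : MultiColoredRel k 1
  | S (i : Fin k) : MultiColoredRel k 1

/-- The relational language of multicolored orderings. -/
def multiColoredLang (k : ℕ) : FirstOrder.Language.{0, 0} := ⟨fun _ => Empty, MultiColoredRel k⟩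

/-- The predicate `R i` of a multicolored ordering. -/
def predR {k : ℕ} {M : Type} [(multiColoredLang k).Structure M] (i : Fin k) (x : M) : Prop :=
  Structure.RelMap (L := multiColoredLang k) (MultiColoredRel.R i) ![x]

/-- The predicate `S i` of a multicolored ordering. -/
def predS {k : ℕ} {M : Type} [(multiColoredLang k).Structure M] (i : Fin k) (x : M) : Prop :=
  Structure.RelMap (L := multiColoredLang k) (MultiColoredRel.S i) ![x]

/-- The axioms of multicolored linear orderings, without any restriction on which points
may be adjacent. -/
structure IsMultiColoredOrder (k : ℕ) (M : Type) [(multiColoredLang k).Structure M] : Prop where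
  linear : IsStrictTotalOrder M fun x y =>
    Structure.RelMap (L := multiColoredLang k) MultiColoredRel.lt ![x, y]
  exists_color : ∀ x : M, ∃ i : Fin k, predR i x ∨ predS i x
  not_R_R : ∀ (x : M) (i j : Fin k), i ≠ j → ¬ (predR i x ∧ predR j x)
  not_R_S : ∀ (x : M) (i j : Fin k), ¬ (predR i x ∧ predS j x)
  R_unique : ∀ (i : Fin k) (x y : M), predR i x → predR i y → x = y
  S_unique : ∀ (i : Fin k) (x y : M), predS i x → predS i y → x = y
  R_S_disjoint : ∀ (i : Fin k) (x y : M), ¬ (predR i x ∧ predS i y)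

/-- The multicolored linear orderings with labels `R i`, `S i` for `i : Fin k`. -/
def multiColoredOrders (k : ℕ) : Set (Bundled.{0} (multiColoredLang k).Structure) :=
  {M | IsMultiColoredOrder k M}

/-- The isomorphism types of the members of a class of structures. -/
def isoTypes {L : FirstOrder.Language.{0, 0}} (K : Set (Bundled.{0} L.Structure)) :
    Set (Quotient (equivSetoid (L := L))) :=
  Quotient.mk equivSetoid '' K

/-- The number of homogeneous linear orderings in `k` colors, up to isomorphism. -/
noncomputable def numHomogeneous (k : ℕ) : ℕ := (isoTypes (homogeneousColoredOrders k)).ncard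

/-- The number of those that use all `k` colors. -/
noncomputable def numHomogeneousAll (k : ℕ) : ℕ := (isoTypes (homogeneousAllColors k)).ncard

/-- The principal branch of the product logarithm: the inverse of `w ↦ w * exp w`
on `[-1, ∞)`. -/
noncomputable def lambertW : ℝ → ℝ :=
  Function.invFunOn (fun w : ℝ => w * Real.exp w) (Set.Ici (-1))

/-- `Z = 2 - W(e²)`. -/
noncomputable def dominantPole : ℝ := 2 - lambertW (Real.exp 2)

/-- `R = -e² / (e^{W(e²)} + e²)`. -/
noncomputable def poleResidue : ℝ :=
  -Real.exp 2 / (Real.exp (lambertW (Real.exp 2)) + Real.exp 2)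

/-!
By homogeneity two points of one color are exchanged by an automorphism, so the color classes are
weakly ordered by lying entirely below one another, and a color occurring only once is comparable
with every other color. Within a class of mutually incomparable colors each color that is not a
single point is dense and unbounded, so by back and forth this weak order, together with the set of
single colors, determines the ordering. Every such pattern is realized by translates of `ℚ`, and the
multicolored orderings are the quotients of the patterns: `R i` marks a point that stands for the
single color `i`, and the `S i` at one point are the colors interleaved there.

Removing the first class of a pattern yields the recursion. Hence the generating function of the
patterns in which all colors occur is `1 / (2 - x - e^x)`, the factor `e^x` choosing which colors
occur. Since `x + e^x - 1` has nonnegative coefficients and takes the value `1` at `Z`, the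
coefficients of its geometric series, rescaled by `Z ^ n`, converge by the renewal theorem; this
replaces singularity analysis and gives the asymptotics of both counts.
-/

open scoped FirstOrder

/-- The combinatorial shape of an ordering whose points carry colors from `α`. Colors that are
interleaved with each other form a block. -/
@[ext]
structure ColorPattern (α : Type*) where
  /-- the color occurs -/
  used : α → Prop
  /-- the color occurs at a single point -/
  single : α → Prop
  /-- all occurrences of the first color precede all occurrences of the second -/
  before : α → α → Prop

namespace ColorPattern

variable {α : Type*} {p : ColorPattern α} {i j l : α}

/-- The patterns that orderings realize: the used colors are strictly weakly ordered, and a color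
of a single point is interleaved with no other color. -/
structure IsWeakOrder (p : ColorPattern α) : Prop where
  used_of_single : ∀ ⦃i⦄, p.single i → p.used i
  used_left : ∀ ⦃i j⦄, p.before i j → p.used i
  used_right : ∀ ⦃i j⦄, p.before i j → p.used j
  irrefl : ∀ i, ¬ p.before i i
  trans : ∀ ⦃i j l⦄, p.before i j → p.before j l → p.before i l
  weak : ∀ ⦃i j l⦄, p.before i j → p.used l → p.before i l ∨ p.before l j
  single_comparable : ∀ ⦃i j⦄, p.single i → p.used j → j ≠ i → p.before i j ∨ p.before j i

instance [Finite α] : Finite (ColorPattern α) :=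
  Finite.of_injective (fun p : ColorPattern α => (p.used, p.single, p.before)) fun p q h => by
    cases p; cases q; simpa using h

/-- Two used colors belong to the same block. -/
def Tied (p : ColorPattern α) (i j : α) : Prop :=
  p.used i ∧ p.used j ∧ ¬ p.before i j ∧ ¬ p.before j i

theorem Tied.symm (h : p.Tied i j) : p.Tied j i :=
  ⟨h.2.1, h.1, h.2.2.2, h.2.2.1⟩

theorem before_or_before_or_tied (hi : p.used i) (hj : p.used j) :
    p.before i j ∨ p.before j i ∨ p.Tied i j := by
  unfold Tied
  tauto

namespace IsWeakOrder

theorem asymm (hp : p.IsWeakOrder) (h : p.before i j) : ¬ p.before j i :=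
  fun h' => hp.irrefl i (hp.trans h h')

theorem tied_self (hp : p.IsWeakOrder) (hi : p.used i) : p.Tied i i :=
  ⟨hi, hi, hp.irrefl i, hp.irrefl i⟩

theorem before_of_tied_left (hp : p.IsWeakOrder) (hij : p.Tied i j) (h : p.before j l) :
    p.before i l :=
  (hp.weak h hij.1).resolve_left hij.2.2.2

theorem before_of_tied_right (hp : p.IsWeakOrder) (h : p.before i j) (hjl : p.Tied j l) :
    p.before i l :=
  (hp.weak h hjl.2.1).resolve_right hjl.2.2.2

theorem tied_trans (hp : p.IsWeakOrder) (hij : p.Tied i j) (hjl : p.Tied j l) : p.Tied i l :=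
  ⟨hij.1, hjl.2.1, fun h => hij.2.2.1 (hp.before_of_tied_right h hjl.symm),
    fun h => hij.2.2.2 (hp.before_of_tied_left hjl h)⟩

theorem eq_of_single_of_tied (hp : p.IsWeakOrder) (hi : p.single i) (h : p.Tied i j) : j = i :=
  by_contra fun hne => (hp.single_comparable hi h.2.1 hne).elim h.2.2.1 h.2.2.2

theorem not_single_of_tied (hp : p.IsWeakOrder) (hi : ¬ p.single i) (h : p.Tied i j) :
    ¬ p.single j := fun hj =>
  hi (hp.eq_of_single_of_tied hj h.symm ▸ hj)

end IsWeakOrder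

/-- The pattern obtained by putting a new first block `B` in front of `p`; `s` tells whether the
new block is a single point. -/
def prepend (B : Set α) (s : Prop) (p : ColorPattern α) : ColorPattern α where
  used i := i ∈ B ∨ p.used i
  single i := (i ∈ B ∧ s) ∨ p.single i
  before i j := (i ∈ B ∧ p.used j) ∨ p.before i j

/-- The pattern in which only the colors in `V` remain. -/
def restrict (V : Set α) (p : ColorPattern α) : ColorPattern α where
  used i := p.used i ∧ i ∈ V
  single i := p.single i ∧ i ∈ V
  before i j := p.before i j ∧ i ∈ V ∧ j ∈ V

/-- The used colors that no color precedes. -/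
def firstBlock (p : ColorPattern α) : Set α :=
  {i | p.used i ∧ ∀ j, ¬ p.before j i}

theorem tied_of_mem_firstBlock (hi : i ∈ p.firstBlock) (hj : j ∈ p.firstBlock) :
    p.Tied i j :=
  ⟨hi.1, hj.1, hj.2 i, hi.2 j⟩

theorem IsWeakOrder.before_of_mem_firstBlock (hp : p.IsWeakOrder) (hi : i ∈ p.firstBlock)
    (hj : p.used j) (hj' : j ∉ p.firstBlock) : p.before i j := by
  obtain ⟨l, hl⟩ : ∃ l, p.before l j := by simpa [firstBlock, hj] using hj'
  exact (hp.weak hl hi.1).resolve_left (hi.2 l)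

theorem IsWeakOrder.firstBlock_nonempty [Finite α] (hp : p.IsWeakOrder) (hi : p.used i) :
    p.firstBlock.Nonempty := by
  have : IsStrictOrder α p.before := { irrefl := hp.irrefl, trans := fun _ _ _ => @hp.trans _ _ _ }
  obtain ⟨m, hm, hmin⟩ :=
    (Finite.wellFounded_of_trans_of_irrefl p.before).has_min {i | p.used i} ⟨i, hi⟩
  exact ⟨m, hm, fun j hj => hmin j (hp.used_left hj) hj⟩

theorem IsWeakOrder.restrict (hp : p.IsWeakOrder) (V : Set α) : (p.restrict V).IsWeakOrder where
  used_of_single _ h := ⟨hp.used_of_single h.1, h.2⟩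
  used_left _ _ h := ⟨hp.used_left h.1, h.2.1⟩
  used_right _ _ h := ⟨hp.used_right h.1, h.2.2⟩
  irrefl i h := hp.irrefl i h.1
  trans _ _ _ h h' := ⟨hp.trans h.1 h'.1, h.2.1, h'.2.2⟩
  weak _ _ _ h hl := (hp.weak h.1 hl.1).imp (⟨·, h.2.1, hl.2⟩) (⟨·, hl.2, h.2.2⟩)
  single_comparable _ _ hi hj hne :=
    (hp.single_comparable hi.1 hj.1 hne).imp (⟨·, hi.2, hj.2⟩) (⟨·, hj.2, hi.2⟩)

theorem prepend_firstBlock_restrict (hp : p.IsWeakOrder) :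
    prepend p.firstBlock (∃ i ∈ p.firstBlock, p.single i) (p.restrict p.firstBlockᶜ) = p := by
  ext i j
  · have : i ∈ p.firstBlock → p.used i := And.left
    simp only [prepend, restrict, Set.mem_compl_iff]
    tauto
  · have single_of_mem (hi : i ∈ p.firstBlock) (h : ∃ j ∈ p.firstBlock, p.single j) :
        p.single i := by
      obtain ⟨j, hj, hs⟩ := h
      rwa [hp.eq_of_single_of_tied hs (tied_of_mem_firstBlock hj hi)]
    simp only [prepend, restrict, Set.mem_compl_iff]
    grind
  · have : p.before i j → p.used j ∧ j ∉ p.firstBlock :=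
      fun h => ⟨hp.used_right h, fun hj => hj.2 i h⟩
    have : i ∈ p.firstBlock → p.used j → j ∉ p.firstBlock → p.before i j :=
      hp.before_of_mem_firstBlock
    simp only [prepend, restrict, Set.mem_compl_iff]
    tauto

section Prepend

variable {B : Set α} {s : Prop}

theorem IsWeakOrder.prepend (hp : p.IsWeakOrder) (hB : ∀ i ∈ B, ¬ p.used i)
    (hs : s → B.Subsingleton) : (prepend B s p).IsWeakOrder where
  used_of_single := by grind [ColorPattern.prepend, hp.used_of_single]
  used_left := by grind [ColorPattern.prepend, hp.used_left]
  used_right := by grind [ColorPattern.prepend, hp.used_right]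
  irrefl := by grind [ColorPattern.prepend, hp.irrefl]
  trans := by grind [ColorPattern.prepend, hp.used_left, hp.used_right, hp.trans]
  weak := by grind [ColorPattern.prepend, hp.used_left, hp.used_right, hp.weak]
  single_comparable := by
    grind [ColorPattern.prepend, Set.Subsingleton, hp.used_of_single, hp.single_comparable]

theorem firstBlock_prepend (hp : p.IsWeakOrder) (hB : ∀ i ∈ B, ¬ p.used i) (hne : B.Nonempty) :
    (prepend B s p).firstBlock = B := by
  obtain ⟨b, hb⟩ := hne
  ext i
  constructor
  · rintro ⟨hi, hmin⟩
    exact hi.resolve_right fun h => hmin b (Or.inl ⟨hb, h⟩)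
  · intro hi
    exact ⟨Or.inl hi, fun j h => hB i hi (h.elim And.right fun h => hp.used_right h)⟩

theorem exists_single_prepend (hp : p.IsWeakOrder) (hB : ∀ i ∈ B, ¬ p.used i)
    (hne : B.Nonempty) : (∃ i ∈ B, (prepend B s p).single i) ↔ s := by
  obtain ⟨b, hb⟩ := hne
  simp only [prepend]
  grind [hp.used_of_single]

theorem restrict_compl_prepend (hp : p.IsWeakOrder) (hB : ∀ i ∈ B, ¬ p.used i) :
    (prepend B s p).restrict Bᶜ = p := by
  ext i j <;> simp only [prepend, restrict, Set.mem_compl_iff]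
  · grind
  · grind [hp.used_of_single]
  · grind [hp.used_left, hp.used_right]

end Prepend

/-- The weak-order patterns whose set of used colors is `U`. -/
def patternsOn (U : Finset α) : Set (ColorPattern α) :=
  {p | p.IsWeakOrder ∧ ∀ i, p.used i ↔ i ∈ U}

theorem patternsOn_empty :
    patternsOn (∅ : Finset α) = {⟨fun _ => False, fun _ => False, fun _ _ => False⟩} := by
  ext p
  constructor
  · rintro ⟨hp, hU⟩
    simp only [Finset.notMem_empty, iff_false] at hU
    ext i j
    · exact iff_of_false (hU i) id
    · exact iff_of_false (fun h => hU i (hp.used_of_single h)) id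
    · exact iff_of_false (fun h => hU i (hp.used_left h)) id
  · rintro rfl
    exact ⟨by constructor <;> simp, by simp⟩

/-- The possible first blocks of a pattern on `U`, with a flag for single points. -/
def firstBlocks (U : Finset α) : Finset (Finset α × Bool) :=
  (U.powerset ×ˢ Finset.univ).filter fun b => b.1.Nonempty ∧ (b.2 = true → b.1.card = 1)

theorem mem_firstBlocks {U : Finset α} {b : Finset α × Bool} :
    b ∈ firstBlocks U ↔ b.1 ⊆ U ∧ b.1.Nonempty ∧ (b.2 = true → b.1.card = 1) := by
  simp [firstBlocks]

/-- The number of kinds of blocks with a given set of colors, as a function of the number of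
colors: one color may form a single point or a dense block. -/
def blockWeight : ℕ → ℕ
  | 0 => 0
  | 1 => 2
  | _ + 2 => 1

theorem sum_firstBlocks (U : Finset α) (f : Finset α → ℕ) :
    ∑ b ∈ firstBlocks U, f b.1 = ∑ B ∈ U.powerset, blockWeight B.card * f B := by
  rw [firstBlocks, Finset.sum_filter, Finset.sum_product]
  refine Finset.sum_congr rfl fun B _ => ?_
  rw [Fintype.sum_bool]
  obtain ⟨n, h⟩ : ∃ n, B.card = n := ⟨_, rfl⟩
  rcases n with _ | _ | n
  · simp [Finset.card_eq_zero.1 h, blockWeight]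
  · have hB : B.Nonempty := Finset.card_pos.1 (by lia)
    simp [hB, h, blockWeight, two_mul]
  · have hB : B.Nonempty := Finset.card_pos.1 (by lia)
    simp [hB, h, blockWeight]

section FirstBlocks

variable [DecidableEq α] {U : Finset α}

theorem not_used_of_mem_patternsOn_sdiff {B : Finset α} (hp : p ∈ patternsOn (U \ B)) :
    ∀ i ∈ (B : Set α), ¬ p.used i := by
  intro i hi
  simpa [hp.2 i] using fun _ => hi

theorem prepend_mem_patternsOn {b : Finset α × Bool} (hb : b ∈ firstBlocks U)
    (hp : p ∈ patternsOn (U \ b.1)) : prepend b.1 (b.2 = true) p ∈ patternsOn U := by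
  obtain ⟨hsub, -, hcard⟩ := mem_firstBlocks.1 hb
  refine ⟨hp.1.prepend (not_used_of_mem_patternsOn_sdiff hp) fun hs => ?_, fun i => ?_⟩
  · obtain ⟨a, ha⟩ := Finset.card_eq_one.1 (hcard hs)
    simp [ha]
  · have := @hsub i
    simp only [prepend, hp.2, Finset.mem_coe, Finset.mem_sdiff]
    tauto

theorem prepend_injective {b b' : Finset α × Bool} {p' : ColorPattern α}
    (hb : b ∈ firstBlocks U) (hb' : b' ∈ firstBlocks U) (hp : p ∈ patternsOn (U \ b.1))
    (hp' : p' ∈ patternsOn (U \ b'.1))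
    (h : prepend b.1 (b.2 = true) p = prepend b'.1 (b'.2 = true) p') : b = b' ∧ p = p' := by
  have hne := Finset.coe_nonempty.2 (mem_firstBlocks.1 hb).2.1
  have hne' := Finset.coe_nonempty.2 (mem_firstBlocks.1 hb').2.1
  have hd := not_used_of_mem_patternsOn_sdiff hp
  have hd' := not_used_of_mem_patternsOn_sdiff hp'
  have hB : b.1 = b'.1 := Finset.coe_injective <| by
    rw [← firstBlock_prepend (s := b.2 = true) hp.1 hd hne, h, firstBlock_prepend hp'.1 hd' hne']
  have hs : b.2 = true ↔ b'.2 = true := by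
    rw [← exists_single_prepend (s := b.2 = true) hp.1 hd hne, h, hB,
      exists_single_prepend hp'.1 hd' hne']
  refine ⟨Prod.ext hB (Bool.eq_iff_iff.2 hs), ?_⟩
  rw [← restrict_compl_prepend (s := b.2 = true) hp.1 hd, h, hB,
    restrict_compl_prepend hp'.1 hd']

theorem exists_eq_prepend [Finite α] (hU : U.Nonempty) (hp : p ∈ patternsOn U) :
    ∃ b ∈ firstBlocks U, ∃ q ∈ patternsOn (U \ b.1), prepend b.1 (b.2 = true) q = p := by
  classical
  obtain ⟨u, hu⟩ := hU
  let B : Finset α := U.filter (· ∈ p.firstBlock)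
  have coe_B : (B : Set α) = p.firstBlock := by
    ext i
    simpa [B, ← hp.2 i] using fun hi : i ∈ p.firstBlock => hi.1
  have mem_B (i : α) : i ∈ B ↔ i ∈ p.firstBlock := by rw [← coe_B, Finset.mem_coe]
  have hB : B.Nonempty := by
    rw [← Finset.coe_nonempty, coe_B]
    exact hp.1.firstBlock_nonempty ((hp.2 u).2 hu)
  refine ⟨(B, decide (∃ i ∈ p.firstBlock, p.single i)),
    mem_firstBlocks.2 ⟨Finset.filter_subset _ _, hB, fun h => ?_⟩,
    p.restrict p.firstBlockᶜ, ⟨hp.1.restrict _, fun i => ?_⟩, ?_⟩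
  · obtain ⟨i, hi, hs⟩ := of_decide_eq_true h
    exact Finset.card_eq_one.2 ⟨i, Finset.eq_singleton_iff_unique_mem.2 ⟨(mem_B i).2 hi,
      fun j hj => hp.1.eq_of_single_of_tied hs
        (tied_of_mem_firstBlock hi ((mem_B j).1 hj))⟩⟩
  · simp [restrict, hp.2 i, mem_B]
  · simpa only [coe_B, decide_eq_true_eq] using prepend_firstBlock_restrict hp.1

end FirstBlocks

/-- The binomial convolution `n ↦ ∑ (n choose i) a i b (n - i)`. It counts the ways to split an
`n`-element set into an `a`-structured and a `b`-structured part. -/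
def binomialConv (a b : ℕ → ℕ) (n : ℕ) : ℕ :=
  ∑ i ∈ Finset.range (n + 1), n.choose i * a i * b (n - i)

theorem sum_powerset_mul [DecidableEq α] (a b : ℕ → ℕ) (U : Finset α) :
    ∑ B ∈ U.powerset, a B.card * b (U \ B).card = binomialConv a b U.card := by
  have (B) (hB : B ∈ U.powerset) : a B.card * b (U \ B).card = a B.card * b (U.card - B.card) := by
    rw [Finset.card_sdiff_of_subset (Finset.mem_powerset.1 hB)]
  rw [Finset.sum_congr rfl this, binomialConv,
    Finset.sum_powerset_apply_card fun m => a m * b (U.card - m)]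
  simp only [smul_eq_mul, mul_assoc]

/-- The number of weak-order patterns with `n` given used colors. -/
def patternCount : ℕ → ℕ
  | 0 => 1
  | n + 1 => ∑ i : Fin (n + 1), (n + 1).choose (i + 1) * blockWeight (i + 1) * patternCount (n - i)

theorem patternCount_zero : patternCount 0 = 1 := by rw [patternCount]

theorem binomialConv_blockWeight_patternCount (n : ℕ) :
    binomialConv blockWeight patternCount (n + 1) = patternCount (n + 1) := by
  rw [patternCount, binomialConv, Finset.sum_range_succ', Finset.sum_range]
  simp [blockWeight]

theorem patternCount_succ_eq_sum_Icc (n : ℕ) :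
    patternCount (n + 1) = 2 * (n + 1) * patternCount n +
      ∑ i ∈ Finset.Icc 2 (n + 1), (n + 1).choose i * patternCount (n + 1 - i) := by
  rw [← binomialConv_blockWeight_patternCount, binomialConv,
    Finset.range_eq_Ico, Finset.sum_eq_sum_Ico_succ_bot (by lia),
    Finset.sum_eq_sum_Ico_succ_bot (by lia), ← Finset.Ico_add_one_right_eq_Icc]
  have weight_eq_one (i) (hi : i ∈ Finset.Ico 2 (n + 1 + 1)) :
      (n + 1).choose i * blockWeight i * patternCount (n + 1 - i) =
        (n + 1).choose i * patternCount (n + 1 - i) := by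
    obtain ⟨m, rfl⟩ := Nat.exists_eq_add_of_le' (Finset.mem_Ico.1 hi).1
    rw [blockWeight, mul_one]
  rw [Finset.sum_congr rfl weight_eq_one]
  simp only [blockWeight, mul_zero, zero_mul, Nat.choose_one_right, zero_add,
    Nat.add_sub_cancel]
  ring

theorem card_patternsOn [Finite α] (U : Finset α) :
    Nat.card (patternsOn U) = patternCount U.card := by
  classical
  induction U using Finset.strongInduction with
  | H U ih =>
  rcases U.eq_empty_or_nonempty with rfl | hU
  · simp [patternsOn_empty, patternCount_zero]
  let e : (Σ b : firstBlocks U, patternsOn (U \ b.1.1)) → patternsOn U := fun x =>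
    ⟨prepend x.1.1.1 (x.1.1.2 = true) x.2.1, prepend_mem_patternsOn x.1.2 x.2.2⟩
  have he : Function.Bijective e := by
    constructor
    · rintro ⟨⟨b, hb⟩, p, hp⟩ ⟨⟨b', hb'⟩, p', hp'⟩ h
      obtain ⟨rfl, rfl⟩ := prepend_injective hb hb' hp hp' (congrArg Subtype.val h)
      rfl
    · rintro ⟨p, hp⟩
      obtain ⟨b, hb, q, hq, rfl⟩ := exists_eq_prepend hU hp
      exact ⟨⟨⟨b, hb⟩, q, hq⟩, rfl⟩
  have card_rest (b : firstBlocks U) :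
      Nat.card (patternsOn (U \ b.1.1)) = patternCount (U \ b.1.1).card := by
    obtain ⟨hsub, hne, -⟩ := mem_firstBlocks.1 b.2
    exact ih _ (Finset.sdiff_ssubset hsub hne)
  obtain ⟨n, hn⟩ := Nat.exists_eq_succ_of_ne_zero hU.card_ne_zero
  rw [← Nat.card_congr (Equiv.ofBijective e he), Nat.card_sigma]
  simp only [card_rest]
  rw [Finset.sum_coe_sort (firstBlocks U) fun b => patternCount (U \ b.1).card,
    sum_firstBlocks U fun B => patternCount (U \ B).card, sum_powerset_mul, hn,
    binomialConv_blockWeight_patternCount]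

/-- The number of weak-order patterns with at most `k` given used colors. -/
def totalCount (k : ℕ) : ℕ := ∑ i ∈ Finset.range (k + 1), patternCount i * k.choose i

theorem ncard_setOf_isWeakOrder [Fintype α] :
    {p : ColorPattern α | p.IsWeakOrder}.ncard = totalCount (Fintype.card α) := by
  classical
  let e : (Σ U : Finset α, patternsOn U) → {p : ColorPattern α | p.IsWeakOrder} :=
    fun x => ⟨x.2.1, x.2.2.1⟩
  have he : Function.Bijective e := by
    constructor
    · rintro ⟨U, p, hp⟩ ⟨U', p', hp'⟩ h
      obtain rfl : p = p' := congrArg Subtype.val h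
      obtain rfl : U = U' := Finset.ext fun i => (hp.2 i).symm.trans (hp'.2 i)
      rfl
    · rintro ⟨p, hp⟩
      exact ⟨⟨Finset.univ.filter p.used, p, hp, by simp⟩, rfl⟩
  rw [← Nat.card_coe_set_eq, ← Nat.card_congr (Equiv.ofBijective e he), Nat.card_sigma]
  simp only [card_patternsOn]
  rw [← Finset.powerset_univ, Finset.sum_powerset_apply_card patternCount, Finset.card_univ]
  simp only [smul_eq_mul, mul_comm, totalCount]

theorem ncard_setOf_isWeakOrder_forall_used [Fintype α] :
    {p : ColorPattern α | p.IsWeakOrder ∧ ∀ i, p.used i}.ncard =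
      patternCount (Fintype.card α) := by
  have : {p : ColorPattern α | p.IsWeakOrder ∧ ∀ i, p.used i} = patternsOn Finset.univ := by
    ext
    simp [patternsOn]
  rw [this, ← Nat.card_coe_set_eq, card_patternsOn, Finset.card_univ]

end ColorPattern

section Renewal

open PowerSeries

theorem summable_norm_of_mk_mul_one_sub_mk {R : Type*} [NormedRing R] {d q : ℕ → R}
    (hq : Summable fun n => ‖q n‖) (hq1 : ∑' n, ‖q n‖ < 1)
    (hdq : PowerSeries.mk d * (1 - PowerSeries.mk q) = 1) : Summable fun n => ‖d n‖ := by
  have d_eq (n : ℕ) : d n =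
      coeff n (1 : PowerSeries R) + ∑ i ∈ Finset.range (n + 1), d i * q (n - i) := by
    have h := congrArg (coeff n) (sub_eq_iff_eq_add.1 ((mul_one_sub _ _).symm.trans hdq))
    simpa only [map_add, coeff_mul, Finset.Nat.sum_antidiagonal_eq_sum_range_succ_mk, coeff_mk]
      using h
  have norm_d_le (n : ℕ) : ‖d n‖ ≤
      ‖coeff n (1 : PowerSeries R)‖ + ∑ i ∈ Finset.range (n + 1), ‖d i‖ * ‖q (n - i)‖ := by
    conv_lhs => rw [d_eq n]
    exact (norm_add_le _ _).trans (add_le_add_right (norm_sum_le_of_le _ fun _ _ =>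
      norm_mul_le _ _) _)
  have sum_norm_coeff_one (N : ℕ) :
      ∑ n ∈ Finset.range N, ‖coeff n (1 : PowerSeries R)‖ ≤ ‖(1 : R)‖ := by
    simp only [coeff_one, apply_ite norm, norm_zero, Finset.sum_ite_eq']
    split_ifs
    exacts [le_rfl, norm_nonneg _]
  have partial_sum_le (N : ℕ) : ∑ n ∈ Finset.range N, ‖d n‖ ≤
      ‖(1 : R)‖ + (∑ n ∈ Finset.range N, ‖d n‖) * ∑' n, ‖q n‖ :=
    calc ∑ n ∈ Finset.range N, ‖d n‖
        ≤ ∑ n ∈ Finset.range N, ‖coeff n (1 : PowerSeries R)‖ +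
            ∑ i ∈ Finset.range N, ∑ j ∈ Finset.range (N - i), ‖d i‖ * ‖q j‖ := by
          rw [← Finset.sum_range_diag_flip N fun i j => ‖d i‖ * ‖q j‖, ← Finset.sum_add_distrib]
          exact Finset.sum_le_sum fun n _ => norm_d_le n
      _ ≤ ‖(1 : R)‖ + (∑ n ∈ Finset.range N, ‖d n‖) * ∑' n, ‖q n‖ := by
          rw [Finset.sum_mul]
          refine add_le_add (sum_norm_coeff_one N) (Finset.sum_le_sum fun i _ => ?_)
          rw [← Finset.mul_sum]
          exact mul_le_mul_of_nonneg_left (hq.sum_le_tsum _ fun _ _ => norm_nonneg _)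
            (norm_nonneg _)
  refine summable_of_sum_range_le (c := ‖(1 : R)‖ / (1 - ∑' n, ‖q n‖)) (fun _ => norm_nonneg _)
    fun N => ?_
  rw [le_div_iff₀ (sub_pos.2 hq1)]
  linarith [partial_sum_le N]

/-- The tail sums `∑_{n > m} p n`. -/
noncomputable def tailSum (p : ℕ → ℝ) (m : ℕ) : ℝ := ∑' i, p (i + (m + 1))

theorem hasSum_tailSum {p : ℕ → ℝ} {μ : ℝ} (hp : ∀ n, 0 ≤ p n)
    (hμ : HasSum (fun n : ℕ => (n : ℝ) * p n) μ) : HasSum (tailSum p) μ := by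
  let f : (Σ n : ℕ, Finset.HasAntidiagonal.antidiagonal n) → ℝ := fun x => p (x.1 + 1)
  have hasSum_fiber (n : ℕ) : HasSum (fun y => f ⟨n, y⟩) (((n + 1 : ℕ) : ℝ) * p (n + 1)) := by
    simpa [f] using hasSum_fintype fun y => f ⟨n, y⟩
  have hμ' : HasSum (fun n => ((n + 1 : ℕ) : ℝ) * p (n + 1)) μ := by
    simpa using (hasSum_nat_add_iff' 1).2 hμ
  have summable_f : Summable f := (summable_sigma_of_nonneg fun _ => hp _).2
    ⟨fun n => (hasSum_fiber n).summable, hμ'.summable.congr fun n => (hasSum_fiber n).tsum_eq.symm⟩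
  have hasSum_prod : HasSum (fun x : ℕ × ℕ => p (x.2 + (x.1 + 1))) μ := by
    rw [← Finset.HasAntidiagonal.sigmaAntidiagonalEquivProd.hasSum_iff]
    refine (hμ'.sigma_of_hasSum hasSum_fiber summable_f).congr_fun fun x => congrArg p ?_
    have := Finset.HasAntidiagonal.mem_antidiagonal.1 x.2.2
    simp only [Finset.HasAntidiagonal.sigmaAntidiagonalEquivProd_apply]
    lia
  exact hasSum_prod.prod_fiberwise fun m => (hasSum_prod.summable.prod_factor m).hasSum

theorem one_sub_X_mul_mk_tailSum {p : ℕ → ℝ} (hp : Summable p) :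
    (1 - X) * PowerSeries.mk (tailSum p) = C (∑' n, p n) - PowerSeries.mk p := by
  ext n
  rcases n with _ | n
  · simp [sub_mul, tailSum, hp.tsum_eq_zero_add]
  · have h := ((summable_nat_add_iff (n + 1)).2 hp).tsum_eq_zero_add
    simp only [zero_add, add_right_comm _ 1] at h
    simp [sub_mul, coeff_succ_X_mul, tailSum, h, add_assoc]

theorem sum_coeff_one_sub_X_mul {R : Type*} [Ring R] (f : PowerSeries R) (n : ℕ) :
    ∑ i ∈ Finset.range (n + 1), coeff i ((1 - X) * f) = coeff n f := by
  induction n with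
  | zero => simp [sub_mul]
  | succ n ih => rw [Finset.sum_range_succ, ih]; simp [sub_mul, coeff_succ_X_mul]

theorem tendsto_renewal {p u : ℕ → ℝ} {μ : ℝ} (hp0 : p 0 = 0) (hp : ∀ n, 0 ≤ p n)
    (hsum : HasSum p 1) (hmean : HasSum (fun n : ℕ => (n : ℝ) * p n) μ) (hμ : μ < 2)
    (hu : PowerSeries.mk u * (1 - PowerSeries.mk p) = 1) :
    Tendsto u atTop (𝓝 (1 / μ)) := by
  let d (n : ℕ) : ℝ := coeff n ((1 - X) * PowerSeries.mk u)
  let q (n : ℕ) : ℝ := if n = 0 then 0 else -tailSum p n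
  have tailSum_nonneg (n : ℕ) : 0 ≤ tailSum p n := tsum_nonneg fun _ => hp _
  have tailSum_zero : tailSum p 0 = 1 := by
    simpa [tailSum, hp0, hsum.tsum_eq] using hsum.summable.tsum_eq_zero_add.symm
  have hasSum_tail : HasSum (tailSum p) μ := hasSum_tailSum hp hmean
  have mk_d_mul_mk_tail : PowerSeries.mk d * PowerSeries.mk (tailSum p) = 1 := by
    have mk_d : PowerSeries.mk d = (1 - X) * PowerSeries.mk u := by
      ext n
      simp only [d, coeff_mk]
    rw [mk_d, mul_right_comm, one_sub_X_mul_mk_tailSum hsum.summable, hsum.tsum_eq, map_one,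
      mul_comm, hu]
  have mk_tail : PowerSeries.mk (tailSum p) = 1 - PowerSeries.mk q := by
    ext n
    rcases n with _ | n <;> simp [q, tailSum_zero, coeff_one]
  have hasSum_norm_q : HasSum (fun n => ‖q n‖) (μ - 1) := by
    refine (hasSum_tail.sub (hasSum_ite_eq 0 1)).congr_fun fun n => ?_
    rcases n with _ | n <;> simp [q, tailSum_zero, abs_of_nonneg, tailSum_nonneg]
  have summable_norm_d : Summable fun n => ‖d n‖ :=
    summable_norm_of_mk_mul_one_sub_mk hasSum_norm_q.summable
      (by rw [hasSum_norm_q.tsum_eq]; linarith) (mk_tail ▸ mk_d_mul_mk_tail)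
  have tsum_d_mul : (∑' n, d n) * μ = 1 := by
    rw [← hasSum_tail.tsum_eq, tsum_mul_tsum_eq_tsum_sum_antidiagonal_of_summable_norm
      summable_norm_d hasSum_tail.summable.norm]
    have h (n : ℕ) := congrArg (coeff n) mk_d_mul_mk_tail
    simp only [coeff_mul, coeff_mk, coeff_one] at h
    simp [h]
  rw [← eq_div_of_mul_eq (right_ne_zero_of_mul_eq_one tsum_d_mul) tsum_d_mul]
  refine ((tendsto_add_atTop_iff_nat 1).2
    summable_norm_d.of_norm.hasSum.tendsto_sum_nat).congr fun n => ?_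
  simp only [d, sum_coeff_one_sub_X_mul, coeff_mk]

end Renewal

theorem tendsto_sub_mul_div_of_hasDerivAt {𝕜 : Type*} [NontriviallyNormedField 𝕜] {f g : 𝕜 → 𝕜}
    {a g' : 𝕜} (hf : ContinuousAt f a) (hg : HasDerivAt g g' a) (ha : g a = 0) (hg' : g' ≠ 0) :
    Tendsto (fun z => (z - a) * (f z / g z)) (𝓝[≠] a) (𝓝 (f a / g')) := by
  have inv_slope := (hasDerivAt_iff_tendsto_slope.1 hg).inv₀ hg'
  rw [div_eq_mul_inv]
  refine ((hf.tendsto.mono_left nhdsWithin_le_nhds).mul inv_slope).congr fun z => ?_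
  rw [slope_def_field, ha, sub_zero, inv_div]
  ring

section Lambert

theorem lambertW_mul_exp {y : ℝ} (hy : -Real.exp (-1) ≤ y) :
    lambertW y * Real.exp (lambertW y) = y := by
  have hcont : ContinuousOn (fun w : ℝ => w * Real.exp w) (Set.Icc (-1) |y|) := by fun_prop
  have hupper : y ≤ |y| * Real.exp |y| :=
    (le_abs_self y).trans (le_mul_of_one_le_right (abs_nonneg y) (Real.one_le_exp (abs_nonneg y)))
  obtain ⟨w, hw, hwy⟩ := intermediate_value_Icc (by linarith [abs_nonneg y]) hcont
    ⟨by simpa using hy, hupper⟩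
  exact Function.invFunOn_eq (f := fun w : ℝ => w * Real.exp w) ⟨w, hw.1, hwy⟩

theorem lambertW_exp_two : lambertW (Real.exp 2) = 2 - dominantPole := by
  rw [dominantPole, sub_sub_cancel]

theorem exp_dominantPole : Real.exp dominantPole = 2 - dominantPole := by
  rw [← lambertW_exp_two, dominantPole, Real.exp_sub, div_eq_iff (Real.exp_pos _).ne',
    lambertW_mul_exp (by linarith [Real.exp_pos (-1), Real.exp_pos 2])]

theorem lt_dominantPole : 0.4428543 < dominantPole := by
  by_contra! h
  have hexp := Real.exp_le_exp.2 h
  rw [exp_dominantPole] at hexp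
  have hbound := Real.exp_bound' (x := 0.4428543) (by norm_num) (by norm_num) (n := 9) (by norm_num)
  norm_num [Finset.sum_range_succ, Nat.factorial] at hexp hbound h
  linarith

theorem dominantPole_lt : dominantPole < 0.4428545 := by
  by_contra! h
  have hexp := Real.exp_le_exp.2 h
  rw [exp_dominantPole] at hexp
  have hbound := Real.sum_le_exp_of_nonneg (x := 0.4428545) (by norm_num) 10
  norm_num [Finset.sum_range_succ, Nat.factorial] at hexp hbound h
  linarith

theorem dominantPole_pos : 0 < dominantPole :=
  lt_trans (by norm_num) lt_dominantPole

theorem dominantPole_lt_one : dominantPole < 1 :=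
  dominantPole_lt.trans (by norm_num)

theorem poleResidue_eq : poleResidue = -(2 - dominantPole) / (3 - dominantPole) := by
  have hW := lambertW_mul_exp (y := Real.exp 2) (by linarith [Real.exp_pos (-1), Real.exp_pos 2])
  have h3 : 3 - dominantPole ≠ 0 := by linarith [dominantPole_lt_one]
  rw [lambertW_exp_two] at hW
  have denominator_eq :
      Real.exp (2 - dominantPole) + (2 - dominantPole) * Real.exp (2 - dominantPole) =
        (3 - dominantPole) * Real.exp (2 - dominantPole) := by ring
  rw [poleResidue, lambertW_exp_two, ← hW, denominator_eq]
  field_simp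

theorem tendsto_poleResidue :
    Tendsto (fun z : ℂ => (z - (dominantPole : ℂ)) * (Complex.exp z / (2 - z - Complex.exp z)))
      (𝓝[≠] (dominantPole : ℂ)) (𝓝 (poleResidue : ℂ)) := by
  have hexp : Complex.exp dominantPole = 2 - dominantPole := by
    exact_mod_cast congrArg Complex.ofReal exp_dominantPole
  have h3 : -(3 - dominantPole : ℂ) ≠ 0 := by
    have : -(3 - dominantPole) ≠ 0 := by linarith [dominantPole_lt_one]
    exact_mod_cast this
  have hderiv : HasDerivAt (fun z : ℂ => 2 - z - Complex.exp z) (-(3 - dominantPole))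
      (dominantPole : ℂ) := by
    refine (((hasDerivAt_id (dominantPole : ℂ)).const_sub 2).sub
      (Complex.hasDerivAt_exp (dominantPole : ℂ))).congr_deriv ?_
    rw [hexp]
    ring
  convert tendsto_sub_mul_div_of_hasDerivAt Complex.continuous_exp.continuousAt hderiv
    (by rw [hexp, sub_self]) h3 using 2
  rw [hexp, poleResidue_eq]
  push_cast
  rw [neg_div, div_neg]

theorem abs_dominantPole_sub_lt : |dominantPole - 0.442854| < 1e-6 := by
  have hlower := lt_dominantPole
  have hupper := dominantPole_lt
  norm_num at hlower hupper ⊢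
  rw [abs_lt]
  constructor <;> linarith

theorem abs_poleResidue_add_lt : |poleResidue + 0.6089389| < 1e-7 := by
  have hlower := lt_dominantPole
  have hupper := dominantPole_lt
  have h3 : 0 < 3 - dominantPole := by linarith [dominantPole_lt_one]
  norm_num at hlower hupper
  rw [poleResidue_eq, abs_lt, div_add' _ _ _ h3.ne', lt_div_iff₀ h3, div_lt_iff₀ h3]
  norm_num
  constructor <;> linarith

theorem abs_one_div_lambertW_sub_lt : |1 / lambertW (Real.exp 2) - 0.6422007| < 1e-7 := by
  have hlower := lt_dominantPole
  have hupper := dominantPole_lt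
  have h2 : 0 < 2 - dominantPole := by linarith [dominantPole_lt_one]
  norm_num at hlower hupper
  rw [lambertW_exp_two, abs_lt, div_sub' h2.ne', lt_div_iff₀ h2, div_lt_iff₀ h2]
  norm_num
  constructor <;> linarith

end Lambert

namespace ColorPattern

section GeneratingFunctions

variable (K : Type*) [Field K] [CharZero K]

/-- The exponential generating function of a sequence of natural numbers. -/
noncomputable def egf (a : ℕ → ℕ) : PowerSeries K := PowerSeries.mk fun n => (a n : K) / n !

theorem egf_binomialConv (a b : ℕ → ℕ) : egf K (binomialConv a b) = egf K a * egf K b := by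
  ext n
  rw [PowerSeries.coeff_mul, Finset.Nat.sum_antidiagonal_eq_sum_range_succ_mk]
  simp only [egf, PowerSeries.coeff_mk, binomialConv]
  rw [Nat.cast_sum, Finset.sum_div]
  refine Finset.sum_congr rfl fun m hm => ?_
  have := Nat.factorial_ne_zero n
  rw [Nat.cast_mul, Nat.cast_mul, Nat.cast_choose K (Nat.le_of_lt_succ (Finset.mem_range.1 hm))]
  field_simp

theorem egf_one : egf K 1 = PowerSeries.exp K := by
  ext n
  simp [egf, PowerSeries.coeff_exp]

theorem one_sub_egf_blockWeight :
    1 - egf K blockWeight = 2 - PowerSeries.X - PowerSeries.exp K := by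
  rw [← map_ofNat PowerSeries.C 2]
  ext n
  rcases n with _ | _ | n
  · norm_num [egf, blockWeight, PowerSeries.coeff_exp]
  · norm_num [egf, blockWeight, PowerSeries.coeff_exp, PowerSeries.coeff_C, PowerSeries.coeff_one]
  · simp [egf, blockWeight, PowerSeries.coeff_exp, PowerSeries.coeff_one, PowerSeries.coeff_X]

theorem egf_patternCount_mul_one_sub : egf K patternCount * (1 - egf K blockWeight) = 1 := by
  rw [mul_one_sub, mul_comm, ← egf_binomialConv]
  ext n
  rcases n with _ | n
  · simp [egf, binomialConv, blockWeight, patternCount_zero]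
  · simp [egf, binomialConv_blockWeight_patternCount, PowerSeries.coeff_one]

theorem egf_totalCount : egf K totalCount = egf K patternCount * PowerSeries.exp K := by
  have totalCount_eq : totalCount = binomialConv patternCount 1 := by
    ext k
    simp [totalCount, binomialConv, mul_comm]
  rw [totalCount_eq, egf_binomialConv, egf_one]

theorem egf_totalCount_eq_exp_mul_inv :
    egf K totalCount = PowerSeries.exp K * (2 - PowerSeries.X - PowerSeries.exp K)⁻¹ := by
  have hinv := egf_patternCount_mul_one_sub K
  rw [one_sub_egf_blockWeight] at hinv
  rw [egf_totalCount, mul_comm, (PowerSeries.eq_inv_iff_mul_eq_one ?_).2 hinv]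
  rw [← one_sub_egf_blockWeight]
  simp [egf, blockWeight]

theorem egf_totalCount_eq_sub :
    egf K totalCount = PowerSeries.C 2 * egf K patternCount -
      PowerSeries.X * egf K patternCount - 1 := by
  have hinv := egf_patternCount_mul_one_sub K
  rw [one_sub_egf_blockWeight] at hinv
  rw [egf_totalCount, map_ofNat]
  linear_combination -hinv

theorem totalCount_succ_div_factorial (n : ℕ) : (totalCount (n + 1) : K) / (n + 1)! =
    2 * ((patternCount (n + 1) : K) / (n + 1)!) - (patternCount n : K) / n ! := by
  have h := congrArg (PowerSeries.coeff (n + 1)) (egf_totalCount_eq_sub K)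
  simpa [egf, PowerSeries.coeff_one, PowerSeries.coeff_succ_X_mul] using h

end GeneratingFunctions

section Asymptotics

theorem hasSum_blockWeight (z : ℝ) :
    HasSum (fun n : ℕ => (blockWeight n : ℝ) / n ! * z ^ n) (Real.exp z + z - 1) := by
  have h := NormedSpace.expSeries_div_hasSum_exp z
  rw [← Real.exp_eq_exp_ℝ] at h
  refine ((h.add (hasSum_ite_eq 1 z)).sub (hasSum_ite_eq 0 1)).congr_fun fun n => ?_
  rcases n with _ | _ | n
  · simp [blockWeight]
  · simp [blockWeight, two_mul]
  · simp [blockWeight, div_eq_inv_mul]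

theorem hasSum_mul_blockWeight (z : ℝ) :
    HasSum (fun n : ℕ => (n : ℝ) * ((blockWeight n : ℝ) / n ! * z ^ n))
      (z * (Real.exp z + 1)) := by
  have h := NormedSpace.expSeries_div_hasSum_exp z
  rw [← Real.exp_eq_exp_ℝ] at h
  rw [← hasSum_nat_add_iff' 1, Finset.sum_range_one, Nat.cast_zero, zero_mul, sub_zero]
  refine ((h.add (hasSum_ite_eq 0 1)).mul_left z).congr_fun fun n => ?_
  rcases n with _ | n
  · simp only [blockWeight, if_pos, zero_add, Nat.factorial_zero, Nat.factorial_one, pow_zero,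
      pow_one, Nat.cast_one, Nat.cast_ofNat]
    ring
  · simp only [blockWeight, Nat.factorial_succ (n + 1), if_neg n.succ_ne_zero]
    push_cast
    field_simp
    ring

theorem tendsto_patternCount :
    Tendsto (fun n : ℕ => (patternCount n : ℝ) / n ! * dominantPole ^ n) atTop
      (𝓝 (1 / (dominantPole * (3 - dominantPole)))) := by
  have hpos := dominantPole_pos
  have mk_rescale (a : ℕ → ℕ) : (PowerSeries.mk fun n => (a n : ℝ) / n ! * dominantPole ^ n) =
      PowerSeries.rescale dominantPole (egf ℝ a) := by
    ext n
    simp [egf, PowerSeries.coeff_rescale, mul_comm]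
  refine tendsto_renewal (p := fun n => (blockWeight n : ℝ) / n ! * dominantPole ^ n)
    (by simp [blockWeight]) (fun n => by positivity) ?_ ?_ ?_ ?_
  · convert hasSum_blockWeight dominantPole using 1
    rw [exp_dominantPole]
    ring
  · convert hasSum_mul_blockWeight dominantPole using 1
    rw [exp_dominantPole]
    ring
  · nlinarith [dominantPole_lt_one]
  · rw [mk_rescale, mk_rescale, ← map_one (PowerSeries.rescale dominantPole), ← map_sub,
      ← map_mul, egf_patternCount_mul_one_sub]

theorem tendsto_totalCount :
    Tendsto (fun n : ℕ => (totalCount n : ℝ) / n ! * dominantPole ^ n) atTop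
      (𝓝 ((2 - dominantPole) / (dominantPole * (3 - dominantPole)))) := by
  rw [← tendsto_add_atTop_iff_nat 1]
  convert (((tendsto_add_atTop_iff_nat 1).2 tendsto_patternCount).const_mul 2).sub
    (tendsto_patternCount.const_mul dominantPole) using 2 with n
  · rw [totalCount_succ_div_factorial]
    ring
  · ring

theorem isEquivalent_totalCount :
    Asymptotics.IsEquivalent atTop (fun k : ℕ => (totalCount k : ℝ))
      (fun k : ℕ => -((k ! : ℝ) * poleResidue * (1 / dominantPole) ^ (k + 1))) := by
  have h1 := dominantPole_pos
  have h2 : 2 - dominantPole ≠ 0 := by linarith [dominantPole_lt_one]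
  have h3 : 3 - dominantPole ≠ 0 := by linarith [dominantPole_lt_one]
  have hratio :=
    tendsto_totalCount.div_const ((2 - dominantPole) / (dominantPole * (3 - dominantPole)))
  rw [div_self (by positivity)] at hratio
  refine Asymptotics.isEquivalent_of_tendsto_one (hratio.congr fun k => ?_)
  rw [Pi.div_apply, poleResidue_eq, one_div, inv_pow, pow_succ]
  field_simp

theorem tendsto_patternCount_div_totalCount :
    Tendsto (fun k : ℕ => (patternCount k : ℝ) / (totalCount k : ℝ)) atTop
      (𝓝 (1 / lambertW (Real.exp 2))) := by
  have h1 := dominantPole_pos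
  have h2 : 2 - dominantPole ≠ 0 := by linarith [dominantPole_lt_one]
  have h3 : 3 - dominantPole ≠ 0 := by linarith [dominantPole_lt_one]
  rw [lambertW_exp_two]
  convert tendsto_patternCount.div tendsto_totalCount (by positivity) using 2 with k
  · rw [Pi.div_apply]
    field_simp
  · field_simp

end Asymptotics

end ColorPattern

section Classification

variable {X β γ : Type*} {f : X → β} {g : X → γ} {K : Set X}

/-- The bijection between the sets of values on `K` of two functions that identify the same
elements of `K`. -/
noncomputable def imageEquivImage (h : ∀ x ∈ K, ∀ y ∈ K, f x = f y ↔ g x = g y) :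
    f '' K ≃ g '' K :=
  have ker_eq : Setoid.ker (K.domRestrict f) = Setoid.ker (K.domRestrict g) :=
    Setoid.ext fun x y => h x x.2 y y.2
  calc f '' K
      ≃ Set.range (K.domRestrict f) := Equiv.setCongr (K.range_domRestrict f).symm
    _ ≃ Quotient (Setoid.ker (K.domRestrict f)) := (Setoid.quotientKerEquivRange _).symm
    _ ≃ Quotient (Setoid.ker (K.domRestrict g)) := Quotient.congrRight fun _ _ => by rw [ker_eq]
    _ ≃ Set.range (K.domRestrict g) := Setoid.quotientKerEquivRange _
    _ ≃ g '' K := Equiv.setCongr (K.range_domRestrict g)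

variable {L : FirstOrder.Language.{0, 0}} {K : Set (Bundled.{0} L.Structure)}
  {f : Bundled.{0} L.Structure → β}

/-- A complete isomorphism invariant of the members of `K` puts its values in bijection with the
isomorphism types. -/
noncomputable def imageEquivIsoTypes
    (hf : ∀ M ∈ K, ∀ N ∈ K, f M = f N ↔ Nonempty (M ≃[L] N)) : f '' K ≃ isoTypes K :=
  imageEquivImage (g := Quotient.mk equivSetoid) fun M hM N hN =>
    (hf M hM N hN).trans (Quotient.eq (r := equivSetoid)).symm

theorem finite_isoTypes [Finite β]
    (hf : ∀ M ∈ K, ∀ N ∈ K, f M = f N ↔ Nonempty (M ≃[L] N)) : (isoTypes K).Finite :=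
  Set.finite_coe_iff.1 ((imageEquivIsoTypes hf).finite_iff.1 inferInstance)

theorem ncard_isoTypes (hf : ∀ M ∈ K, ∀ N ∈ K, f M = f N ↔ Nonempty (M ≃[L] N)) :
    (isoTypes K).ncard = (f '' K).ncard :=
  (Nat.card_congr (imageEquivIsoTypes hf)).symm

end Classification

section RelMap

open FirstOrder.Language.Structure

variable {L : FirstOrder.Language} {M N F : Type*} [L.Structure M] [L.Structure N] [FunLike F M N]
  [StrongHomClass L F M N]

theorem relMap_vec_one_map (e : F) (r : L.Relations 1) (x : M) :
    RelMap r ![e x] ↔ RelMap r ![x] := by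
  rw [← StrongHomClass.map_rel e r ![x], ← FinVec.map_eq e ![x] ]
  rfl

theorem relMap_vec_two_map (e : F) (r : L.Relations 2) (x y : M) :
    RelMap r ![e x, e y] ↔ RelMap r ![x, y] := by
  rw [← StrongHomClass.map_rel e r ![x, y], ← FinVec.map_eq e ![x, y] ]
  rfl

end RelMap

section MultiColored

variable {k : ℕ} {M N : Type} [(multiColoredLang k).Structure M] [(multiColoredLang k).Structure N]
  {i j : Fin k} {x y z : M}

/-- The order relation of a multicolored ordering. -/
def multiLt (k : ℕ) {M : Type} [(multiColoredLang k).Structure M] (x y : M) : Prop :=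
  Structure.RelMap (L := multiColoredLang k) MultiColoredRel.lt ![x, y]

/-- The point `x` carries the label `i`, as `R i` or as `S i`. -/
def hasLabel (i : Fin k) (x : M) : Prop := predR i x ∨ predS i x

theorem multiColored_relMap_comp_iff {f : M → N}
    (hlt : ∀ x y, multiLt k (f x) (f y) ↔ multiLt k x y)
    (hR : ∀ (i : Fin k) x, predR i (f x) ↔ predR i x)
    (hS : ∀ (i : Fin k) x, predS i (f x) ↔ predS i x)
    {n : ℕ} (r : (multiColoredLang k).Relations n) (v : Fin n → M) :
    Structure.RelMap r (f ∘ v) ↔ Structure.RelMap r v := by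
  change MultiColoredRel k n at r
  rw [← FinVec.etaExpand_eq v, ← FinVec.map_eq]
  cases r with
  | lt => exact hlt _ _
  | R i => exact hR _ _
  | S i => exact hS _ _

theorem multiLt_equiv (e : M ≃[multiColoredLang k] N) (x y : M) :
    multiLt k (e x) (e y) ↔ multiLt k x y :=
  relMap_vec_two_map e _ x y

theorem predR_equiv (e : M ≃[multiColoredLang k] N) (i : Fin k) (x : M) :
    predR i (e x) ↔ predR i x :=
  relMap_vec_one_map e _ x

theorem hasLabel_equiv (e : M ≃[multiColoredLang k] N) (i : Fin k) (x : M) :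
    hasLabel i (e x) ↔ hasLabel i x :=
  or_congr (predR_equiv e i x) (relMap_vec_one_map e _ x)

variable (k M) in
/-- The pattern of a multicolored ordering: the labels of a point form a block, which is a single
point of the pattern if the label is an `R`. -/
def multiPattern : ColorPattern (Fin k) where
  used i := ∃ x : M, hasLabel i x
  single i := ∃ x : M, predR i x
  before i j := ∃ x y : M, hasLabel i x ∧ hasLabel j y ∧ multiLt k x y

theorem multiPattern_congr (e : M ≃[multiColoredLang k] N) :
    multiPattern k M = multiPattern k N := by
  ext i j
  · exact e.toEquiv.exists_congr fun x => (hasLabel_equiv e i x).symm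
  · exact e.toEquiv.exists_congr fun x => (predR_equiv e i x).symm
  · exact e.toEquiv.exists_congr fun x => e.toEquiv.exists_congr fun y =>
      and_congr (hasLabel_equiv e i x).symm
        (and_congr (hasLabel_equiv e j y).symm (multiLt_equiv e x y).symm)

namespace IsMultiColoredOrder

theorem lt_irrefl (hM : IsMultiColoredOrder k M) (x : M) : ¬ multiLt k x x := hM.linear.irrefl x

theorem lt_trans (hM : IsMultiColoredOrder k M) : multiLt k x y → multiLt k y z → multiLt k x z :=
  hM.linear.trans x y z

theorem lt_trichotomy (hM : IsMultiColoredOrder k M) (x y : M) :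
    multiLt k x y ∨ x = y ∨ multiLt k y x :=
  have : IsStrictTotalOrder M (multiLt k) := hM.linear
  trichotomous_of (multiLt k) x y

theorem eq_of_hasLabel (hM : IsMultiColoredOrder k M) (hx : hasLabel i x) (hy : hasLabel i y) :
    x = y := by
  rcases hx with hx | hx <;> rcases hy with hy | hy
  · exact hM.R_unique i x y hx hy
  · exact absurd ⟨hx, hy⟩ (hM.R_S_disjoint i x y)
  · exact absurd ⟨hy, hx⟩ (hM.R_S_disjoint i y x)
  · exact hM.S_unique i x y hx hy

theorem eq_of_predR_of_hasLabel (hM : IsMultiColoredOrder k M) (hi : predR i x)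
    (hj : hasLabel j x) : j = i := by
  rcases hj with hj | hj
  · exact by_contra fun hne => hM.not_R_R x j i hne ⟨hj, hi⟩
  · exact absurd ⟨hi, hj⟩ (hM.not_R_S x i j)

theorem before_iff (hM : IsMultiColoredOrder k M) (hx : hasLabel i x) (hy : hasLabel j y) :
    (multiPattern k M).before i j ↔ multiLt k x y := by
  constructor
  · rintro ⟨x', y', hx', hy', h⟩
    rwa [hM.eq_of_hasLabel hx hx', hM.eq_of_hasLabel hy hy']
  · exact fun h => ⟨x, y, hx, hy, h⟩

theorem predR_iff (hM : IsMultiColoredOrder k M) (hx : hasLabel i x) :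
    predR i x ↔ (multiPattern k M).single i := by
  constructor
  · exact fun h => ⟨x, h⟩
  · rintro ⟨y, hy⟩
    rwa [hM.eq_of_hasLabel hx (Or.inl hy)]

theorem predS_iff (hM : IsMultiColoredOrder k M) (hx : hasLabel i x) :
    predS i x ↔ ¬ (multiPattern k M).single i := by
  rw [← hM.predR_iff hx]
  constructor
  · exact fun h h' => hM.R_S_disjoint i x x ⟨h', h⟩
  · exact fun h => hx.resolve_left h

theorem isWeakOrder (hM : IsMultiColoredOrder k M) : (multiPattern k M).IsWeakOrder where
  used_of_single := fun _ ⟨x, hx⟩ => ⟨x, Or.inl hx⟩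
  used_left := fun _ _ ⟨x, _, hx, _⟩ => ⟨x, hx⟩
  used_right := fun _ _ ⟨_, y, _, hy, _⟩ => ⟨y, hy⟩
  irrefl := fun i ⟨x, y, hx, hy, h⟩ => hM.lt_irrefl x ((hM.eq_of_hasLabel hx hy).symm ▸ h)
  trans := by
    rintro i j l ⟨x, y, hx, hy, h⟩ ⟨y', z, hy', hz, h'⟩
    rw [← hM.eq_of_hasLabel hy hy'] at h'
    exact ⟨x, z, hx, hz, hM.lt_trans h h'⟩
  weak := by
    rintro i j l ⟨x, y, hx, hy, h⟩ ⟨z, hz⟩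
    rcases hM.lt_trichotomy x z with hxz | rfl | hzx
    · exact Or.inl ⟨x, z, hx, hz, hxz⟩
    · exact Or.inr ⟨x, y, hz, hy, h⟩
    · exact Or.inr ⟨z, y, hz, hy, hM.lt_trans hzx h⟩
  single_comparable := by
    rintro i j ⟨x, hx⟩ ⟨y, hy⟩ hji
    rcases hM.lt_trichotomy x y with h | rfl | h
    · exact Or.inl ⟨x, y, Or.inl hx, hy, h⟩
    · exact absurd (hM.eq_of_predR_of_hasLabel hx hy) hji
    · exact Or.inr ⟨y, x, hy, Or.inl hx, h⟩

theorem hasLabel_iff_tied (hM : IsMultiColoredOrder k M) (hx : hasLabel i x) :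
    hasLabel j x ↔ (multiPattern k M).Tied i j := by
  constructor
  · intro hj
    refine ⟨⟨x, hx⟩, ⟨x, hj⟩, ?_, ?_⟩
    · exact mt (hM.before_iff hx hj).1 (hM.lt_irrefl x)
    · exact mt (hM.before_iff hj hx).1 (hM.lt_irrefl x)
  · rintro ⟨-, ⟨y, hy⟩, hij, hji⟩
    rw [hM.before_iff hx hy] at hij
    rw [hM.before_iff hy hx] at hji
    rwa [((hM.lt_trichotomy x y).resolve_left hij).resolve_right hji]

theorem exists_hasLabel_iff (hM : IsMultiColoredOrder k M) (hN : IsMultiColoredOrder k N)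
    (h : multiPattern k M = multiPattern k N) (x : M) :
    ∃ y : N, ∀ i : Fin k, hasLabel i y ↔ hasLabel i x := by
  obtain ⟨i, hi⟩ := hM.exists_color x
  obtain ⟨y, hy⟩ : (multiPattern k N).used i := h ▸ ⟨x, hi⟩
  exact ⟨y, fun j => by rw [hM.hasLabel_iff_tied hi, hN.hasLabel_iff_tied hy, h]⟩

theorem nonempty_equiv (hM : IsMultiColoredOrder k M) (hN : IsMultiColoredOrder k N)
    (h : multiPattern k M = multiPattern k N) :
    Nonempty (M ≃[multiColoredLang k] N) := by
  choose f hf using hM.exists_hasLabel_iff hN h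
  choose g hg using hN.exists_hasLabel_iff hM h.symm
  have left_inv (x) : g (f x) = x := by
    obtain ⟨i, hi⟩ := hM.exists_color x
    exact hM.eq_of_hasLabel ((hg _ i).2 ((hf _ i).2 hi)) hi
  have right_inv (y) : f (g y) = y := by
    obtain ⟨i, hi⟩ := hN.exists_color y
    exact hN.eq_of_hasLabel ((hf _ i).2 ((hg _ i).2 hi)) hi
  have lt_iff (x y : M) : multiLt k (f x) (f y) ↔ multiLt k x y := by
    obtain ⟨i, hi⟩ := hM.exists_color x
    obtain ⟨j, hj⟩ := hM.exists_color y
    rw [← hM.before_iff hi hj, h, hN.before_iff ((hf x i).2 hi) ((hf y j).2 hj)]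
  have predR_iff (i : Fin k) (x : M) : predR i (f x) ↔ predR i x := by
    by_cases hi : hasLabel i x
    · rw [hM.predR_iff hi, h, hN.predR_iff ((hf x i).2 hi)]
    · exact iff_of_false (fun h' => hi ((hf x i).1 (Or.inl h'))) fun h' => hi (Or.inl h')
  have predS_iff (i : Fin k) (x : M) : predS i (f x) ↔ predS i x := by
    by_cases hi : hasLabel i x
    · rw [hM.predS_iff hi, h, hN.predS_iff ((hf x i).2 hi)]
    · exact iff_of_false (fun h' => hi ((hf x i).1 (Or.inr h'))) fun h' => hi (Or.inr h')
  exact ⟨⟨⟨f, g, left_inv, right_inv⟩, fun F => F.elim,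
    multiColored_relMap_comp_iff lt_iff predR_iff predS_iff⟩⟩

end IsMultiColoredOrder

namespace ColorPattern

/-- The blocks of `p`, that is, the classes of used colors under `Tied`. -/
def Block {α : Type*} (p : ColorPattern α) : Type _ :=
  {B : Set α // ∃ i, p.used i ∧ B = {j | p.Tied i j}}

namespace Block

variable {p : ColorPattern (Fin k)} {B C : Block p}

/-- Blocks are ordered as their colors, and the colors of a block label it by `R` if the block is
a single point and by `S` otherwise. -/
instance : (multiColoredLang k).Structure (Block p) where
  funMap := fun F => F.elim
  RelMap := fun {n} (r : MultiColoredRel k n) => match n, r with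
    | _, .lt => fun v => ∃ i ∈ (v 0).1, ∃ j ∈ (v 1).1, p.before i j
    | _, .R i => fun v => i ∈ (v 0).1 ∧ p.single i
    | _, .S i => fun v => i ∈ (v 0).1 ∧ ¬ p.single i

theorem predR_iff : predR i B ↔ i ∈ B.1 ∧ p.single i := Iff.rfl

theorem predS_iff : predS i B ↔ i ∈ B.1 ∧ ¬ p.single i := Iff.rfl

theorem hasLabel_iff : hasLabel i B ↔ i ∈ B.1 := by
  rw [hasLabel, predR_iff, predS_iff, ← and_or_left, and_iff_left (em _)]

theorem used_of_mem (hi : i ∈ B.1) : p.used i := by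
  obtain ⟨b, -, hB⟩ := B.2
  rw [hB] at hi
  exact hi.2.1

theorem exists_mem (hp : p.IsWeakOrder) (B : Block p) : ∃ i, i ∈ B.1 := by
  obtain ⟨_, b, hb, rfl⟩ := B
  exact ⟨b, hp.tied_self hb⟩

theorem exists_mem_of_used (hp : p.IsWeakOrder) (hi : p.used i) : ∃ B : Block p, i ∈ B.1 :=
  ⟨⟨_, i, hi, rfl⟩, hp.tied_self hi⟩

theorem mem_iff_tied (hp : p.IsWeakOrder) (hi : i ∈ B.1) : j ∈ B.1 ↔ p.Tied i j := by
  obtain ⟨b, -, hB⟩ := B.2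
  rw [hB] at hi ⊢
  exact ⟨fun hj => hp.tied_trans hi.symm hj, fun h => hp.tied_trans hi h⟩

theorem eq_of_tied (hp : p.IsWeakOrder) (hi : i ∈ B.1) (hj : j ∈ C.1) (h : p.Tied i j) :
    B = C := by
  refine Subtype.ext (Set.ext fun l => ?_)
  rw [mem_iff_tied hp hi, mem_iff_tied hp hj]
  exact ⟨hp.tied_trans h.symm, hp.tied_trans h⟩

theorem multiLt_iff (hp : p.IsWeakOrder) (hi : i ∈ B.1) (hj : j ∈ C.1) :
    multiLt k B C ↔ p.before i j := by
  refine ⟨?_, fun h => ⟨i, hi, j, hj, h⟩⟩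
  rintro ⟨i', hi', j', hj', h⟩
  exact hp.before_of_tied_left ((mem_iff_tied hp hi).1 hi')
    (hp.before_of_tied_right h ((mem_iff_tied hp hj').1 hj))

theorem isStrictTotalOrder (hp : p.IsWeakOrder) :
    IsStrictTotalOrder (Block p) (multiLt k) where
  trichotomous B C hBC hCB := by
    obtain ⟨i, hi⟩ := exists_mem hp B
    obtain ⟨j, hj⟩ := exists_mem hp C
    rw [multiLt_iff hp hi hj] at hBC
    rw [multiLt_iff hp hj hi] at hCB
    exact eq_of_tied hp hi hj ⟨used_of_mem hi, used_of_mem hj, hBC, hCB⟩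
  irrefl B h := by
    obtain ⟨i, hi⟩ := exists_mem hp B
    exact hp.irrefl i ((multiLt_iff hp hi hi).1 h)
  trans B C D hBC hCD := by
    obtain ⟨i, hi⟩ := exists_mem hp B
    obtain ⟨j, hj⟩ := exists_mem hp C
    obtain ⟨l, hl⟩ := exists_mem hp D
    rw [multiLt_iff hp hi hj] at hBC
    rw [multiLt_iff hp hj hl] at hCD
    exact (multiLt_iff hp hi hl).2 (hp.trans hBC hCD)

theorem isMultiColoredOrder (hp : p.IsWeakOrder) : IsMultiColoredOrder k (Block p) where
  linear := isStrictTotalOrder hp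
  exists_color B := (exists_mem hp B).imp fun _ => hasLabel_iff.2
  not_R_R B i j hij h :=
    hij (hp.eq_of_single_of_tied h.2.2 ((mem_iff_tied hp h.2.1).1 h.1.1))
  not_R_S B i j h := by
    obtain rfl := hp.eq_of_single_of_tied h.1.2 ((mem_iff_tied hp h.1.1).1 h.2.1)
    exact h.2.2 h.1.2
  R_unique i B C hB hC := eq_of_tied hp hB.1 hC.1 (hp.tied_self (used_of_mem hB.1))
  S_unique i B C hB hC := eq_of_tied hp hB.1 hC.1 (hp.tied_self (used_of_mem hB.1))
  R_S_disjoint i B C h := h.2.2 h.1.2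

theorem multiPattern_eq (hp : p.IsWeakOrder) : multiPattern k (Block p) = p := by
  ext i j
  · refine (exists_congr fun B => hasLabel_iff).trans ⟨?_, exists_mem_of_used hp⟩
    exact fun ⟨B, hi⟩ => used_of_mem hi
  · refine ⟨fun ⟨B, hi⟩ => hi.2, fun hs => ?_⟩
    obtain ⟨B, hi⟩ := exists_mem_of_used hp (hp.used_of_single hs)
    exact ⟨B, hi, hs⟩
  · constructor
    · rintro ⟨B, C, hi, hj, h⟩
      exact (multiLt_iff hp (hasLabel_iff.1 hi) (hasLabel_iff.1 hj)).1 h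
    · intro h
      obtain ⟨B, hi⟩ := exists_mem_of_used hp (hp.used_left h)
      obtain ⟨C, hj⟩ := exists_mem_of_used hp (hp.used_right h)
      exact ⟨B, C, hasLabel_iff.2 hi, hasLabel_iff.2 hj, (multiLt_iff hp hi hj).2 h⟩

end Block

end ColorPattern

theorem multiPattern_eq_iff_of_mem (M : Bundled.{0} (multiColoredLang k).Structure)
    (hM : M ∈ multiColoredOrders k) (N : Bundled.{0} (multiColoredLang k).Structure)
    (hN : N ∈ multiColoredOrders k) :
    multiPattern k M = multiPattern k N ↔ Nonempty (M ≃[multiColoredLang k] N) :=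
  ⟨IsMultiColoredOrder.nonempty_equiv hM hN, fun ⟨e⟩ => multiPattern_congr e⟩

theorem image_multiPattern_multiColoredOrders :
    (fun M : Bundled.{0} (multiColoredLang k).Structure => multiPattern k M) ''
      multiColoredOrders k = {p | p.IsWeakOrder} := by
  ext p
  constructor
  · rintro ⟨M, hM, rfl⟩
    exact IsMultiColoredOrder.isWeakOrder hM
  · intro hp
    exact ⟨⟨p.Block, inferInstance⟩, ColorPattern.Block.isMultiColoredOrder hp,
      ColorPattern.Block.multiPattern_eq hp⟩

theorem finite_isoTypes_multiColoredOrders (k : ℕ) : (isoTypes (multiColoredOrders k)).Finite :=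
  finite_isoTypes multiPattern_eq_iff_of_mem

theorem ncard_isoTypes_multiColoredOrders (k : ℕ) :
    (isoTypes (multiColoredOrders k)).ncard = ColorPattern.totalCount k := by
  rw [ncard_isoTypes multiPattern_eq_iff_of_mem, image_multiPattern_multiColoredOrders,
    ColorPattern.ncard_setOf_isWeakOrder, Fintype.card_fin]

end MultiColored

section Colored

variable {k : ℕ} {M N : Type} [(coloredOrderLang k).Structure M] [(coloredOrderLang k).Structure N]
  {i j l : Fin k} {x y z : M}

instance (n : ℕ) : IsEmpty ((coloredOrderLang k).Functions n) := inferInstanceAs (IsEmpty Empty)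

instance : IsEmpty ((coloredOrderLang k).Relations 0) := ⟨fun r => by
  change ColoredOrderRel k 0 at r
  cases r⟩

/-- The order relation of a colored ordering. -/
def colLt (k : ℕ) {M : Type} [(coloredOrderLang k).Structure M] (x y : M) : Prop :=
  Structure.RelMap (L := coloredOrderLang k) ColoredOrderRel.lt ![x, y]

/-- The point `x` has color `i`. -/
def hasColor (i : Fin k) (x : M) : Prop :=
  Structure.RelMap (L := coloredOrderLang k) (ColoredOrderRel.color i) ![x]

theorem colored_relMap_comp_iff {f : M → N}
    (hlt : ∀ x y, colLt k (f x) (f y) ↔ colLt k x y)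
    (hcol : ∀ (i : Fin k) x, hasColor i (f x) ↔ hasColor i x)
    {n : ℕ} (r : (coloredOrderLang k).Relations n) (v : Fin n → M) :
    Structure.RelMap r (f ∘ v) ↔ Structure.RelMap r v := by
  change ColoredOrderRel k n at r
  rw [← FinVec.etaExpand_eq v, ← FinVec.map_eq]
  cases r with
  | lt => exact hlt _ _
  | color i => exact hcol _ _

theorem colLt_map {F : Type*} [FunLike F M N] [StrongHomClass (coloredOrderLang k) F M N]
    (e : F) (x y : M) : colLt k (e x) (e y) ↔ colLt k x y :=
  relMap_vec_two_map e _ x y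

theorem hasColor_map {F : Type*} [FunLike F M N] [StrongHomClass (coloredOrderLang k) F M N]
    (e : F) (i : Fin k) (x : M) : hasColor i (e x) ↔ hasColor i x :=
  relMap_vec_one_map e _ x

variable (k M) in
/-- The pattern of a colored ordering: it records only which color classes are singletons, and
which ones lie entirely below which other ones. -/
def colPattern : ColorPattern (Fin k) where
  used i := ∃ x : M, hasColor i x
  single i := ∃ x : M, hasColor i x ∧ ∀ y : M, hasColor i y → y = x
  before i j := (∃ x : M, hasColor i x) ∧ (∃ y : M, hasColor j y) ∧
    ∀ x y : M, hasColor i x → hasColor j y → colLt k x y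

theorem colPattern_congr (e : M ≃[coloredOrderLang k] N) : colPattern k M = colPattern k N := by
  have used_iff (i : Fin k) : (∃ x : M, hasColor i x) ↔ ∃ x : N, hasColor i x :=
    e.toEquiv.exists_congr fun x => (hasColor_map e i x).symm
  ext i j
  · exact used_iff i
  · exact e.toEquiv.exists_congr fun x => and_congr (hasColor_map e i x).symm <|
      e.toEquiv.forall_congr fun y =>
        imp_congr (hasColor_map e i y).symm e.toEquiv.apply_eq_iff_eq.symm
  · exact and_congr (used_iff i) <| and_congr (used_iff j) <|
      e.toEquiv.forall_congr fun x => e.toEquiv.forall_congr fun y =>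
        imp_congr (hasColor_map e i x).symm <|
          imp_congr (hasColor_map e j y).symm (colLt_map e x y).symm

variable (M) in
theorem exists_not_colLt_of_not_before (hi : (colPattern k M).used i)
    (hj : (colPattern k M).used j) (h : ¬ (colPattern k M).before i j) :
    ∃ x y : M, hasColor i x ∧ hasColor j y ∧ ¬ colLt k x y := by
  by_contra! hlt
  exact h ⟨hi, hj, hlt⟩

variable (k) in
/-- `f` preserves the order and the colors of the points of `s`; between colored linear orderings
it is then an isomorphism from `s` onto its image. -/
structure IsPartialIso (f : M → N) (s : Set M) : Prop where
  map_lt : ∀ ⦃x⦄, x ∈ s → ∀ ⦃y⦄, y ∈ s → colLt k x y → colLt k (f x) (f y)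
  map_color : ∀ ⦃x⦄, x ∈ s → ∀ ⦃i : Fin k⦄, hasColor i x → hasColor i (f x)

theorem isPartialIso_extend (S : (coloredOrderLang k).Substructure M)
    (f : S ↪[coloredOrderLang k] N) (g : M → N) :
    IsPartialIso k (Function.extend Subtype.val f g) (S : Set M) where
  map_lt := by
    intro x hx y hy h
    lift x to S using hx
    lift y to S using hy
    rw [Subtype.val_injective.extend_apply, Subtype.val_injective.extend_apply, colLt_map]
    exact (colLt_map S.subtype x y).1 h
  map_color := by
    intro x hx i h
    lift x to S using hx
    rw [Subtype.val_injective.extend_apply, hasColor_map]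
    exact (hasColor_map S.subtype i x).1 h

namespace IsColoredLinearOrder

theorem lt_irrefl (hM : IsColoredLinearOrder k M) (x : M) : ¬ colLt k x x := hM.linear.irrefl x

theorem lt_trans (hM : IsColoredLinearOrder k M) : colLt k x y → colLt k y z → colLt k x z :=
  hM.linear.trans x y z

theorem lt_asymm (hM : IsColoredLinearOrder k M) (h : colLt k x y) : ¬ colLt k y x :=
  fun h' => hM.lt_irrefl x (hM.lt_trans h h')

theorem lt_trichotomy (hM : IsColoredLinearOrder k M) (x y : M) :
    colLt k x y ∨ x = y ∨ colLt k y x :=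
  have : IsStrictTotalOrder M (colLt k) := hM.linear
  trichotomous_of (colLt k) x y

theorem lt_or_lt_of_ne (hM : IsColoredLinearOrder k M) (h : x ≠ y) : colLt k x y ∨ colLt k y x :=
  (hM.lt_trichotomy x y).imp_right fun h' => h'.resolve_left h

theorem exists_hasColor (hM : IsColoredLinearOrder k M) (x : M) : ∃ i : Fin k, hasColor i x :=
  (hM.color x).exists

theorem eq_of_hasColor (hM : IsColoredLinearOrder k M) (hi : hasColor i x) (hj : hasColor j x) :
    i = j :=
  (hM.color x).unique hi hj

theorem ne_of_hasColor (hM : IsColoredLinearOrder k M) (hi : hasColor i x) (hj : hasColor j y)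
    (hij : i ≠ j) : x ≠ y := by
  rintro rfl
  exact hij (hM.eq_of_hasColor hi hj)

theorem map_lt_of_not_tied (hM : IsColoredLinearOrder k M)
    (h : colPattern k M = colPattern k N) {x' y' : N} (hx : hasColor i x) (hy : hasColor j y)
    (hx' : hasColor i x') (hy' : hasColor j y') (hij : ¬ (colPattern k M).Tied i j)
    (hlt : colLt k x y) : colLt k x' y' := by
  rcases ColorPattern.before_or_before_or_tied (p := colPattern k M) ⟨x, hx⟩ ⟨y, hy⟩
    with hb | hb | ht
  · rw [h] at hb
    exact hb.2.2 x' y' hx' hy'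
  · exact absurd (hb.2.2 y x hy hx) (hM.lt_asymm hlt)
  · exact absurd ht hij

end IsColoredLinearOrder

namespace IsPartialIso

variable {f : M → N} {s : Set M} {m : M} {n : N}

protected theorem congr {g : M → N} (hf : IsPartialIso k f s) (h : Set.EqOn g f s) :
    IsPartialIso k g s where
  map_lt x hx y hy hxy := by
    rw [h hx, h hy]
    exact hf.map_lt hx hy hxy
  map_color x hx i hi := by
    rw [h hx]
    exact hf.map_color hx hi

protected theorem insert (hM : IsColoredLinearOrder k M) (hf : IsPartialIso k f s)
    (hcol : ∀ i : Fin k, hasColor i m → hasColor i (f m))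
    (hlt : ∀ x ∈ s, colLt k x m → colLt k (f x) (f m))
    (hgt : ∀ x ∈ s, colLt k m x → colLt k (f m) (f x)) :
    IsPartialIso k f (insert m s) where
  map_lt := by
    rintro x (rfl | hx) y (rfl | hy) h
    · exact absurd h (hM.lt_irrefl _)
    · exact hgt y hy h
    · exact hlt x hx h
    · exact hf.map_lt hx hy h
  map_color := by
    rintro x (rfl | hx) i hi
    · exact hcol i hi
    · exact hf.map_color hx hi

protected theorem update [DecidableEq M] (hM : IsColoredLinearOrder k M)
    (hf : IsPartialIso k f s) (hm : m ∉ s) (hcol : ∀ i : Fin k, hasColor i m → hasColor i n)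
    (hlt : ∀ x ∈ s, colLt k x m → colLt k (f x) n)
    (hgt : ∀ x ∈ s, colLt k m x → colLt k n (f x)) :
    IsPartialIso k (Function.update f m n) (insert m s) := by
  have eqOn : Set.EqOn (Function.update f m n) f s := fun x hx =>
    Function.update_of_ne (ne_of_mem_of_not_mem hx hm) _ _
  refine (hf.congr eqOn).insert hM ?_ ?_ ?_ <;> rw [Function.update_self]
  · exact hcol
  · exact fun x hx => (eqOn hx).symm ▸ hlt x hx
  · exact fun x hx => (eqOn hx).symm ▸ hgt x hx

theorem map_lt_iff (hM : IsColoredLinearOrder k M) (hN : IsColoredLinearOrder k N)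
    (hf : IsPartialIso k f s) (hx : x ∈ s) (hy : y ∈ s) :
    colLt k (f x) (f y) ↔ colLt k x y := by
  refine ⟨fun h => ?_, hf.map_lt hx hy⟩
  rcases hM.lt_trichotomy x y with hxy | rfl | hyx
  · exact hxy
  · exact absurd h (hN.lt_irrefl _)
  · exact absurd h (hN.lt_asymm (hf.map_lt hy hx hyx))

theorem map_color_iff (hM : IsColoredLinearOrder k M) (hN : IsColoredLinearOrder k N)
    (hf : IsPartialIso k f s) (hx : x ∈ s) : hasColor i (f x) ↔ hasColor i x := by
  refine ⟨fun h => ?_, fun h => hf.map_color hx h⟩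
  obtain ⟨j, hj⟩ := hM.exists_hasColor x
  rwa [hN.eq_of_hasColor h (hf.map_color hx hj)]

theorem injOn (hM : IsColoredLinearOrder k M) (hN : IsColoredLinearOrder k N)
    (hf : IsPartialIso k f s) : Set.InjOn f s := by
  intro x hx y hy h
  by_contra hne
  rcases hM.lt_or_lt_of_ne hne with hxy | hyx
  · exact hN.lt_irrefl _ (h ▸ hf.map_lt hx hy hxy)
  · exact hN.lt_irrefl _ (h ▸ hf.map_lt hy hx hyx)

/-- A partial isomorphism on the universe of a substructure, as an embedding. -/
def embedding (hM : IsColoredLinearOrder k M) (hN : IsColoredLinearOrder k N)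
    {S : (coloredOrderLang k).Substructure M} (hf : IsPartialIso k f (S : Set M)) :
    S ↪[coloredOrderLang k] N where
  toFun x := f x
  inj' x y h := Subtype.ext (hf.injOn hM hN x.2 y.2 h)
  map_fun' := fun F => F.elim
  map_rel' := colored_relMap_comp_iff
    (fun x y => (hf.map_lt_iff hM hN x.2 y.2).trans (colLt_map S.subtype x y))
    fun i x => (hf.map_color_iff hM hN x.2).trans (hasColor_map S.subtype i x)

end IsPartialIso

section Homogeneous

variable {s : Set M} {f : M → M}

namespace IsColoredLinearOrder

theorem exists_automorphism_eqOn (hM : IsColoredLinearOrder k M)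
    (hom : (coloredOrderLang k).IsUltrahomogeneous M) (hs : s.Finite) (hf : IsPartialIso k f s) :
    ∃ g : M ≃[coloredOrderLang k] M, Set.EqOn g f s := by
  rw [← Substructure.closure_eq_of_isRelational (coloredOrderLang k) s] at hf ⊢
  obtain ⟨g, hg⟩ := hom _ (Substructure.fg_closure hs) (hf.embedding hM hM)
  exact ⟨g, fun x hx => (DFunLike.congr_fun hg ⟨x, hx⟩).symm⟩

theorem isPartialIso_const (hM : IsColoredLinearOrder k M) (hx : hasColor i x) {y : N}
    (hy : hasColor i y) : IsPartialIso k (Function.const M y) {x} where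
  map_lt := by
    rintro _ rfl _ rfl h
    exact absurd h (hM.lt_irrefl _)
  map_color := by
    rintro _ rfl j hj
    rwa [hM.eq_of_hasColor hj hx]

theorem exists_automorphism_apply_eq (hM : IsColoredLinearOrder k M)
    (hom : (coloredOrderLang k).IsUltrahomogeneous M) (hx : hasColor i x) (hy : hasColor i y) :
    ∃ g : M ≃[coloredOrderLang k] M, g x = y := by
  obtain ⟨g, hg⟩ := hM.exists_automorphism_eqOn hom (Set.finite_singleton x)
    (hM.isPartialIso_const hx hy)
  exact ⟨g, hg rfl⟩

theorem exists_automorphism_apply_eq_and_apply_eq (hM : IsColoredLinearOrder k M)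
    (hom : (coloredOrderLang k).IsUltrahomogeneous M) {x' y' : M} (hx : hasColor i x)
    (hx' : hasColor i x') (hy : hasColor j y) (hy' : hasColor j y') (h : colLt k x y)
    (h' : colLt k x' y') : ∃ g : M ≃[coloredOrderLang k] M, g x = x' ∧ g y = y' := by
  classical
  have hyx : y ≠ x := by
    rintro rfl
    exact hM.lt_irrefl _ h
  have iso : IsPartialIso k (Function.update (Function.const M x') y y') {y, x} := by
    refine (hM.isPartialIso_const hx hx').update hM hyx ?_ ?_ ?_
    · exact fun l hl => hM.eq_of_hasColor hy hl ▸ hy'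
    · exact fun _ _ _ => h'
    · rintro _ rfl hlt
      exact absurd hlt (hM.lt_asymm h)
  obtain ⟨g, hg⟩ := hM.exists_automorphism_eqOn hom (Set.toFinite _) iso
  refine ⟨g, ?_, ?_⟩
  · rw [hg (Or.inr rfl), Function.update_of_ne hyx.symm, Function.const_apply]
  · rw [hg (Or.inl rfl), Function.update_self]

theorem before_or_before_of_before (hM : IsColoredLinearOrder k M)
    (hom : (coloredOrderLang k).IsUltrahomogeneous M) (h : (colPattern k M).before i j)
    (hl : (colPattern k M).used l) :
    (colPattern k M).before i l ∨ (colPattern k M).before l j := by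
  by_contra! hc
  obtain ⟨x, z, hx, hz, hxz⟩ := exists_not_colLt_of_not_before M h.1 hl hc.1
  obtain ⟨z', y, hz', hy, hzy⟩ := exists_not_colLt_of_not_before M hl h.2.1 hc.2
  obtain ⟨g, rfl⟩ := hM.exists_automorphism_apply_eq hom hz' hz
  have hxy : colLt k x (g y) := h.2.2 x (g y) hx ((hasColor_map g j y).2 hy)
  rw [← colLt_map g] at hzy
  rcases hM.lt_trichotomy x (g z') with hlt | rfl | hgt
  · exact hxz hlt
  · exact hzy hxy
  · exact hzy (hM.lt_trans hgt hxy)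

theorem before_or_before_of_single (hM : IsColoredLinearOrder k M)
    (hom : (coloredOrderLang k).IsUltrahomogeneous M) (hi : (colPattern k M).single i)
    (hj : (colPattern k M).used j) (hji : j ≠ i) :
    (colPattern k M).before i j ∨ (colPattern k M).before j i := by
  obtain ⟨x, hx, eq_x⟩ := hi
  by_contra! hc
  obtain ⟨_, y, hx₁, hy, hxy⟩ := exists_not_colLt_of_not_before M ⟨x, hx⟩ hj hc.1
  obtain ⟨y', _, hy', hx₂, hyx⟩ := exists_not_colLt_of_not_before M hj ⟨x, hx⟩ hc.2
  rw [eq_x _ hx₁] at hxy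
  rw [eq_x _ hx₂] at hyx
  obtain ⟨g, rfl⟩ := hM.exists_automorphism_apply_eq hom hy hy'
  have hgx : g x = x := eq_x _ ((hasColor_map g i x).2 hx)
  rw [← hgx, colLt_map] at hyx
  exact (hM.lt_or_lt_of_ne (hM.ne_of_hasColor hx hy hji.symm)).elim hxy hyx

theorem isWeakOrder_colPattern (hM : IsColoredLinearOrder k M)
    (hom : (coloredOrderLang k).IsUltrahomogeneous M) : (colPattern k M).IsWeakOrder where
  used_of_single := fun _ ⟨x, hx, _⟩ => ⟨x, hx⟩
  used_left := fun _ _ h => h.1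
  used_right := fun _ _ h => h.2.1
  irrefl := fun _ ⟨⟨x, hx⟩, _, h⟩ => hM.lt_irrefl x (h x x hx hx)
  trans := fun _ _ _ ⟨hi, ⟨y, hy⟩, h⟩ ⟨_, hl, h'⟩ =>
    ⟨hi, hl, fun x z hx hz => hM.lt_trans (h x y hx hy) (h' y z hy hz)⟩
  weak := fun _ _ _ => hM.before_or_before_of_before hom
  single_comparable := fun _ _ => hM.before_or_before_of_single hom

theorem exists_lt_of_tied (hM : IsColoredLinearOrder k M) (hij : (colPattern k M).Tied i j)
    (hi : ¬ (colPattern k M).single i) : ∃ x y : M, hasColor i x ∧ hasColor j y ∧ colLt k x y := by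
  obtain ⟨i_used, j_used, -, hji⟩ := hij
  rcases eq_or_ne i j with rfl | hne
  · obtain ⟨x, hx⟩ := i_used
    obtain ⟨y, hy, hyx⟩ : ∃ y : M, hasColor i y ∧ y ≠ x := by
      by_contra! eq_x
      exact hi ⟨x, hx, eq_x⟩
    rcases hM.lt_or_lt_of_ne hyx with h | h
    · exact ⟨y, x, hy, hx, h⟩
    · exact ⟨x, y, hx, hy, h⟩
  · obtain ⟨y, x, hy, hx, h⟩ := exists_not_colLt_of_not_before M j_used i_used hji
    exact ⟨x, y, hx, hy, (hM.lt_or_lt_of_ne (hM.ne_of_hasColor hx hy hne)).resolve_right h⟩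

end IsColoredLinearOrder

variable (k M) in
/-- A colored linear ordering whose pattern is a weak ordering and in which each color of a block
that is not a singleton is dense and unbounded in that block. Countable orderings of this kind are
determined by their patterns, by a back-and-forth argument. -/
structure IsGenericColored : Prop extends IsColoredLinearOrder k M where
  isWeakOrder : (colPattern k M).IsWeakOrder
  exists_gt : ∀ ⦃i j : Fin k⦄, (colPattern k M).Tied i j → ¬ (colPattern k M).single i →
    ∀ ⦃x : M⦄, hasColor j x → ∃ z, hasColor i z ∧ colLt k x z
  exists_lt : ∀ ⦃i j : Fin k⦄, (colPattern k M).Tied i j → ¬ (colPattern k M).single i →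
    ∀ ⦃x : M⦄, hasColor j x → ∃ z, hasColor i z ∧ colLt k z x
  exists_between : ∀ ⦃i j l : Fin k⦄, (colPattern k M).Tied i j → (colPattern k M).Tied i l →
    ¬ (colPattern k M).single i → ∀ ⦃x y : M⦄, hasColor j x → hasColor l y → colLt k x y →
    ∃ z, hasColor i z ∧ colLt k x z ∧ colLt k z y

theorem IsColoredLinearOrder.isGenericColored (hM : IsColoredLinearOrder k M)
    (hom : (coloredOrderLang k).IsUltrahomogeneous M) : IsGenericColored k M := by
  have hp := hM.isWeakOrder_colPattern hom
  have exists_gt {i j : Fin k} (hij : (colPattern k M).Tied i j)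
      (hi : ¬ (colPattern k M).single i) {x : M} (hx : hasColor j x) :
      ∃ z, hasColor i z ∧ colLt k x z := by
    obtain ⟨a, b, ha, hb, hab⟩ := hM.exists_lt_of_tied hij.symm (hp.not_single_of_tied hi hij)
    obtain ⟨g, rfl⟩ := hM.exists_automorphism_apply_eq hom ha hx
    exact ⟨g b, (hasColor_map g i b).2 hb, (colLt_map g a b).2 hab⟩
  refine ⟨hM, hp, fun _ _ hij hi _ => exists_gt hij hi, ?_, ?_⟩
  · intro i j hij hi x hx
    obtain ⟨a, b, ha, hb, hab⟩ := hM.exists_lt_of_tied hij hi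
    obtain ⟨g, rfl⟩ := hM.exists_automorphism_apply_eq hom hb hx
    exact ⟨g a, (hasColor_map g i a).2 ha, (colLt_map g a b).2 hab⟩
  · intro i j l hij hil hi x y hx hy hxy
    obtain ⟨z, hz, hxz⟩ := exists_gt hij hi hx
    obtain ⟨w, hw, hzw⟩ := exists_gt hil.symm (hp.not_single_of_tied hi hil) hz
    obtain ⟨g, hgx, rfl⟩ :=
      hM.exists_automorphism_apply_eq_and_apply_eq hom hx hx hw hy (hM.lt_trans hxz hzw) hxy
    refine ⟨g z, (hasColor_map g i z).2 hz, ?_, (colLt_map g z w).2 hzw⟩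
    rwa [← hgx, colLt_map]

end Homogeneous

theorem exists_mem_between_of_finite {α : Type*} [LinearOrder α] {A B D : Set α}
    (hA : A.Finite) (hB : B.Finite) (hD : D.Nonempty) (exists_gt : ∀ a ∈ A, ∃ d ∈ D, a < d)
    (exists_lt : ∀ b ∈ B, ∃ d ∈ D, d < b)
    (exists_between : ∀ a ∈ A, ∀ b ∈ B, ∃ d ∈ D, a < d ∧ d < b) :
    ∃ d ∈ D, (∀ a ∈ A, a < d) ∧ ∀ b ∈ B, d < b := by
  rcases A.eq_empty_or_nonempty with rfl | A_nonempty <;>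
    rcases B.eq_empty_or_nonempty with rfl | B_nonempty
  · exact hD.imp fun d hd => ⟨hd, by simp, by simp⟩
  · obtain ⟨b, hb, b_min⟩ := Set.exists_min_image B id hB B_nonempty
    obtain ⟨d, hd, hdb⟩ := exists_lt b hb
    exact ⟨d, hd, by simp, fun b' hb' => hdb.trans_le (b_min b' hb')⟩
  · obtain ⟨a, ha, a_max⟩ := Set.exists_max_image A id hA A_nonempty
    obtain ⟨d, hd, had⟩ := exists_gt a ha
    exact ⟨d, hd, fun a' ha' => (a_max a' ha').trans_lt had, by simp⟩
  · obtain ⟨a, ha, a_max⟩ := Set.exists_max_image A id hA A_nonempty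
    obtain ⟨b, hb, b_min⟩ := Set.exists_min_image B id hB B_nonempty
    obtain ⟨d, hd, had, hdb⟩ := exists_between a ha b hb
    exact ⟨d, hd, fun a' ha' => (a_max a' ha').trans_lt had,
      fun b' hb' => hdb.trans_le (b_min b' hb')⟩

namespace IsGenericColored

theorem exists_between_finite (hN : IsGenericColored k N) (hi : (colPattern k N).used i)
    (hs : ¬ (colPattern k N).single i) {A B : Set N} (hA : A.Finite) (hB : B.Finite)
    (hAi : ∀ a ∈ A, ∃ j, hasColor j a ∧ (colPattern k N).Tied i j)
    (hBi : ∀ b ∈ B, ∃ j, hasColor j b ∧ (colPattern k N).Tied i j)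
    (hAB : ∀ a ∈ A, ∀ b ∈ B, colLt k a b) :
    ∃ n, hasColor i n ∧ (∀ a ∈ A, colLt k a n) ∧ ∀ b ∈ B, colLt k n b := by
  classical
  have : IsStrictTotalOrder N (colLt k) := hN.linear
  let : LinearOrder N := linearOrderOfSTO (colLt k)
  refine exists_mem_between_of_finite (D := {n | hasColor i n}) hA hB hi ?_ ?_ ?_
  · intro a ha
    obtain ⟨j, hj, hij⟩ := hAi a ha
    exact hN.exists_gt hij hs hj
  · intro b hb
    obtain ⟨j, hj, hij⟩ := hBi b hb
    exact hN.exists_lt hij hs hj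
  · intro a ha b hb
    obtain ⟨j, hj, hij⟩ := hAi a ha
    obtain ⟨l, hl, hil⟩ := hBi b hb
    exact hN.exists_between hij hil hs hj hl (hAB a ha b hb)

variable {s : Set M} {f : M → N} {m : M}

theorem exists_image_of_not_single (hM : IsGenericColored k M) (hN : IsGenericColored k N)
    (h : colPattern k M = colPattern k N) (hs : s.Finite) (hf : IsPartialIso k f s)
    (hi : hasColor i m) (hsi : ¬ (colPattern k M).single i)
    (tied : ∀ x ∈ s, ∃ j, hasColor j x ∧ (colPattern k M).Tied i j) :
    ∃ n, hasColor i n ∧ ∀ x ∈ s,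
      (colLt k x m → colLt k (f x) n) ∧ (colLt k m x → colLt k n (f x)) := by
  have tied_map : ∀ x ∈ s, ∃ j, hasColor j (f x) ∧ (colPattern k N).Tied i j := fun x hx =>
    (tied x hx).imp fun j hj => ⟨hf.map_color hx hj.1, h ▸ hj.2⟩
  obtain ⟨n, hn, hlt, hgt⟩ := hN.exists_between_finite (h ▸ ⟨m, hi⟩) (h ▸ hsi)
    (A := f '' {x ∈ s | colLt k x m}) (B := f '' {x ∈ s | colLt k m x})
    ((hs.sep _).image f) ((hs.sep _).image f)
    (Set.forall_mem_image.2 fun x hx => tied_map x hx.1)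
    (Set.forall_mem_image.2 fun x hx => tied_map x hx.1)
    (Set.forall_mem_image.2 fun x hx => Set.forall_mem_image.2 fun y hy =>
      hf.map_lt hx.1 hy.1 (hM.lt_trans hx.2 hy.2))
  exact ⟨n, hn, fun x hx => ⟨fun hxm => hlt _ ⟨x, ⟨hx, hxm⟩, rfl⟩,
    fun hmx => hgt _ ⟨x, ⟨hx, hmx⟩, rfl⟩⟩⟩

theorem exists_image (hM : IsGenericColored k M) (hN : IsGenericColored k N)
    (h : colPattern k M = colPattern k N) (hs : s.Finite) (hf : IsPartialIso k f s) (hm : m ∉ s)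
    (hi : hasColor i m) :
    ∃ n, hasColor i n ∧ ∀ x ∈ s,
      (colLt k x m → colLt k (f x) n) ∧ (colLt k m x → colLt k n (f x)) := by
  let t : Set M := {x ∈ s | ∃ j, hasColor j x ∧ (colPattern k M).Tied i j}
  obtain ⟨n, hn, lt_and_gt⟩ : ∃ n, hasColor i n ∧ ∀ x ∈ t,
      (colLt k x m → colLt k (f x) n) ∧ (colLt k m x → colLt k n (f x)) := by
    by_cases hsi : (colPattern k M).single i
    · obtain ⟨n, hn⟩ : (colPattern k N).used i := h ▸ ⟨m, hi⟩
      refine ⟨n, hn, ?_⟩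
      rintro x ⟨hx, j, hj, hij⟩
      obtain rfl := hM.isWeakOrder.eq_of_single_of_tied hsi hij
      obtain ⟨y, -, eq_y⟩ := hsi
      exact absurd ((eq_y x hj).trans (eq_y m hi).symm ▸ hx) hm
    · exact hM.exists_image_of_not_single hN h (hs.sep _)
        ⟨fun _ hx _ hy => hf.map_lt hx.1 hy.1, fun _ hx => hf.map_color hx.1⟩ hi hsi
        fun x hx => hx.2
  refine ⟨n, hn, fun x hx => ?_⟩
  by_cases hxt : x ∈ t
  · exact lt_and_gt x hxt
  · obtain ⟨j, hj⟩ := hM.exists_hasColor x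
    have not_tied : ¬ (colPattern k M).Tied i j := fun hij => hxt ⟨hx, j, hj, hij⟩
    have hfx : hasColor j (f x) := hf.map_color hx hj
    exact ⟨hM.map_lt_of_not_tied h hj hi hfx hn (mt ColorPattern.Tied.symm not_tied),
      hM.map_lt_of_not_tied h hi hj hn hfx not_tied⟩

theorem exists_extension (hM : IsGenericColored k M) (hN : IsGenericColored k N)
    (h : colPattern k M = colPattern k N) (hs : s.Finite) (hf : IsPartialIso k f s) (m : M) :
    ∃ g : M → N, IsPartialIso k g (insert m s) ∧ Set.EqOn g f s := by
  classical
  by_cases hm : m ∈ s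
  · exact ⟨f, by rwa [Set.insert_eq_of_mem hm], Set.eqOn_refl f s⟩
  · obtain ⟨i, hi⟩ := hM.exists_hasColor m
    obtain ⟨n, hn, lt_and_gt⟩ := hM.exists_image hN h hs hf hm hi
    refine ⟨Function.update f m n, ?_, fun x hx =>
      Function.update_of_ne (ne_of_mem_of_not_mem hx hm) _ _⟩
    exact hf.update hM.toIsColoredLinearOrder hm (fun j hj => hM.eq_of_hasColor hi hj ▸ hn)
      (fun x hx => (lt_and_gt x hx).1) fun x hx => (lt_and_gt x hx).2

theorem isExtensionPair (hM : IsGenericColored k M) (hN : IsGenericColored k N)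
    (h : colPattern k M = colPattern k N) : (coloredOrderLang k).IsExtensionPair M N := by
  rw [isExtensionPair_iff_exists_embedding_closure_singleton_sup]
  intro S hS f m
  obtain ⟨i, hi⟩ := hM.exists_hasColor m
  obtain ⟨n, -⟩ : (colPattern k N).used i := h ▸ ⟨m, hi⟩
  obtain ⟨g, hg, eqOn⟩ := hM.exists_extension hN h (Set.finite_coe_iff.1 hS.finite)
    (isPartialIso_extend S f fun _ => n) m
  have coe_sup : ((Substructure.closure (coloredOrderLang k) {m} ⊔ S :
      (coloredOrderLang k).Substructure M) : Set M) = insert m (S : Set M) := by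
    rw [← Substructure.closure_eq S, ← Substructure.closure_union,
      Substructure.closure_eq_of_isRelational, Substructure.closure_eq_of_isRelational,
      Set.singleton_union]
  rw [← coe_sup] at hg
  refine ⟨hg.embedding hM.toIsColoredLinearOrder hN.toIsColoredLinearOrder, ?_⟩
  ext x
  exact ((eqOn x.2).trans (Subtype.val_injective.extend_apply _ _ x)).symm

theorem nonempty_equiv [Countable M] [Countable N] (hM : IsGenericColored k M)
    (hN : IsGenericColored k N) (h : colPattern k M = colPattern k N) :
    Nonempty (M ≃[coloredOrderLang k] N) := by
  obtain ⟨e, -⟩ := equiv_between_cg (L := coloredOrderLang k) Structure.cg_of_countable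
    Structure.cg_of_countable default (hM.isExtensionPair hN h) (hN.isExtensionPair hM h.symm)
  exact ⟨e⟩

theorem isUltrahomogeneous [Countable M] (hM : IsGenericColored k M) :
    (coloredOrderLang k).IsUltrahomogeneous M :=
  (isUltrahomogeneous_iff_IsExtensionPair Structure.cg_of_countable).2 (hM.isExtensionPair hM rfl)

end IsGenericColored

end Colored

section GenericOrder

variable {k : ℕ} {p : ColorPattern (Fin k)} {i j : Fin k}

/-- The points of a countable homogeneous colored ordering with pattern `p`: one copy of the
rationals for each color, reduced to its origin if the color occurs only once. -/
def GenericOrder (p : ColorPattern (Fin k)) : Type :=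
  {x : Fin k × ℚ // p.used x.1 ∧ (p.single x.1 → x.2 = 0)}

namespace GenericOrder

instance : Countable (GenericOrder p) := inferInstanceAs (Countable (Subtype _))

/-- The place of a point in its block. The translates of `ℚ` by distinct multiples of `√2` are
disjoint, so all colors of a block can be placed densely in `ℝ` without meeting. -/
noncomputable def position (x : GenericOrder p) : ℝ := x.1.2 + x.1.1 * √2

theorem position_injective : Function.Injective (position (p := p)) := by
  rintro ⟨⟨i, q⟩, hi⟩ ⟨⟨j, r⟩, hj⟩ h
  have h : (q + i * √2 : ℝ) = r + j * √2 := h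
  obtain rfl : i = j := by
    by_contra hij
    have sub_ne_zero : (i - j : ℝ) ≠ 0 := sub_ne_zero.2 (by exact_mod_cast Fin.val_ne_of_ne hij)
    refine irrational_sqrt_two ⟨(r - q) / (i - j), ?_⟩
    push_cast
    rw [div_eq_iff sub_ne_zero]
    linarith
  have hqr : q = r := by exact_mod_cast add_right_cancel h
  exact Subtype.ext (Prod.ext rfl hqr)

/-- Points of different blocks are ordered as their blocks, points of one block by position. -/
instance : (coloredOrderLang k).Structure (GenericOrder p) where
  funMap := fun F => F.elim
  RelMap := fun {n} (r : ColoredOrderRel k n) => match n, r with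
    | _, .lt => fun v => p.before (v 0).1.1 (v 1).1.1 ∨
        (¬ p.before (v 1).1.1 (v 0).1.1 ∧ (v 0).position < (v 1).position)
    | _, .color i => fun v => (v 0).1.1 = i

variable {x y : GenericOrder p}

theorem colLt_iff : colLt k x y ↔
    p.before x.1.1 y.1.1 ∨ (¬ p.before y.1.1 x.1.1 ∧ x.position < y.position) := Iff.rfl

theorem hasColor_iff : hasColor i x ↔ x.1.1 = i := Iff.rfl

theorem colLt_of_before (h : p.before i j) (hx : hasColor i x) (hy : hasColor j y) :
    colLt k x y := by
  obtain rfl := hasColor_iff.1 hx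
  obtain rfl := hasColor_iff.1 hy
  exact Or.inl h

theorem colLt_iff_of_tied (h : p.Tied i j) (hx : hasColor i x) (hy : hasColor j y) :
    colLt k x y ↔ x.position < y.position := by
  obtain rfl := hasColor_iff.1 hx
  obtain rfl := hasColor_iff.1 hy
  rw [colLt_iff, or_iff_right h.2.2.1, and_iff_right h.2.2.2]

theorem exists_hasColor (hi : p.used i) : ∃ x : GenericOrder p, hasColor i x :=
  ⟨⟨(i, 0), hi, fun _ => rfl⟩, rfl⟩

theorem exists_position_between (hi : p.used i) (hs : ¬ p.single i) {a b : ℝ} (hab : a < b) :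
    ∃ z : GenericOrder p, hasColor i z ∧ a < z.position ∧ z.position < b := by
  obtain ⟨q, hq⟩ := exists_rat_btwn (sub_lt_sub_right hab (i * √2))
  exact ⟨⟨(i, q), hi, fun h => absurd h hs⟩, rfl, sub_lt_iff_lt_add.1 hq.1,
    lt_sub_iff_add_lt.1 hq.2⟩

theorem isStrictTotalOrder (hp : p.IsWeakOrder) :
    IsStrictTotalOrder (GenericOrder p) (colLt k) where
  trichotomous x y hxy hyx := by
    rw [colLt_iff] at hxy hyx
    push Not at hxy hyx
    exact position_injective (le_antisymm (hyx.2 hxy.1) (hxy.2 hyx.1))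
  irrefl x h := by
    rcases colLt_iff.1 h with h | h
    · exact hp.irrefl _ h
    · exact lt_irrefl _ h.2
  trans x y z hxy hyz := by
    rw [colLt_iff] at *
    rcases hxy with hxy | ⟨hxy, lt_xy⟩ <;> rcases hyz with hyz | ⟨hyz, lt_yz⟩
    · exact Or.inl (hp.trans hxy hyz)
    · exact Or.inl ((hp.weak hxy z.2.1).resolve_right hyz)
    · exact Or.inl ((hp.weak hyz x.2.1).resolve_left hxy)
    · exact Or.inr ⟨fun h => (hp.weak h y.2.1).elim hyz hxy, lt_xy.trans lt_yz⟩

theorem isColoredLinearOrder (hp : p.IsWeakOrder) : IsColoredLinearOrder k (GenericOrder p) where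
  linear := isStrictTotalOrder hp
  color x := ⟨x.1.1, rfl, fun _ hj => (hasColor_iff.1 hj).symm⟩

theorem used_colPattern_iff : (colPattern k (GenericOrder p)).used i ↔ p.used i := by
  refine ⟨?_, exists_hasColor⟩
  rintro ⟨x, rfl⟩
  exact x.2.1

theorem single_colPattern_iff (hp : p.IsWeakOrder) :
    (colPattern k (GenericOrder p)).single i ↔ p.single i := by
  constructor
  · rintro ⟨x, hx, eq_x⟩
    by_contra hs
    obtain ⟨z, hz, hxz, -⟩ :=
      exists_position_between (used_colPattern_iff.1 ⟨x, hx⟩) hs (lt_add_one x.position)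
    exact hxz.ne' (congrArg position (eq_x z hz))
  · intro hs
    refine ⟨⟨(i, 0), hp.used_of_single hs, fun _ => rfl⟩, rfl, ?_⟩
    rintro ⟨⟨_, q⟩, hq⟩ rfl
    exact Subtype.ext (Prod.ext rfl (hq.2 hs))

theorem before_of_before_colPattern (hp : p.IsWeakOrder)
    (h : (colPattern k (GenericOrder p)).before i j) : p.before i j := by
  obtain ⟨⟨x, hx⟩, ⟨y, hy⟩, lt_of_color⟩ := h
  have hM := isColoredLinearOrder hp
  have i_used : p.used i := used_colPattern_iff.1 ⟨x, hx⟩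
  rcases ColorPattern.before_or_before_or_tied i_used (used_colPattern_iff.1 ⟨y, hy⟩)
    with hij | hji | tied
  · exact hij
  · exact absurd (lt_of_color x y hx hy) (hM.lt_asymm (colLt_of_before hji hy hx))
  · by_cases hs : p.single i
    · obtain rfl := hp.eq_of_single_of_tied hs tied
      exact absurd (lt_of_color x x hx hx) (hM.lt_irrefl x)
    · obtain ⟨z, hz, hyz, -⟩ := exists_position_between i_used hs (lt_add_one y.position)
      exact absurd ((colLt_iff_of_tied tied hz hy).1 (lt_of_color z y hz hy)) hyz.asymm

theorem colPattern_eq (hp : p.IsWeakOrder) : colPattern k (GenericOrder p) = p := by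
  ext i j
  · exact used_colPattern_iff
  · exact single_colPattern_iff hp
  · refine ⟨before_of_before_colPattern hp, fun h => ?_⟩
    exact ⟨exists_hasColor (hp.used_left h), exists_hasColor (hp.used_right h),
      fun x y => colLt_of_before h⟩

theorem isGenericColored (hp : p.IsWeakOrder) : IsGenericColored k (GenericOrder p) := by
  refine ⟨isColoredLinearOrder hp, ?_, ?_, ?_, ?_⟩ <;> rw [colPattern_eq hp]
  · exact hp
  · intro i j hij hi x hx
    obtain ⟨z, hz, hxz, -⟩ := exists_position_between hij.1 hi (lt_add_one x.position)
    exact ⟨z, hz, (colLt_iff_of_tied hij.symm hx hz).2 hxz⟩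
  · intro i j hij hi x hx
    obtain ⟨z, hz, -, hzx⟩ := exists_position_between hij.1 hi (sub_one_lt x.position)
    exact ⟨z, hz, (colLt_iff_of_tied hij hz hx).2 hzx⟩
  · intro i j l hij hil hi x y hx hy hxy
    have position_lt := (colLt_iff_of_tied (hp.tied_trans hij.symm hil) hx hy).1 hxy
    obtain ⟨z, hz, hxz, hzy⟩ := exists_position_between hij.1 hi position_lt
    exact ⟨z, hz, (colLt_iff_of_tied hij.symm hx hz).2 hxz, (colLt_iff_of_tied hil hz hy).2 hzy⟩

theorem mem_homogeneousColoredOrders (hp : p.IsWeakOrder) :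
    ⟨GenericOrder p, inferInstance⟩ ∈ homogeneousColoredOrders k :=
  ⟨inferInstanceAs (Countable (GenericOrder p)), isColoredLinearOrder hp,
    (isGenericColored hp).isUltrahomogeneous⟩

end GenericOrder

theorem colPattern_eq_iff_of_mem (M : Bundled.{0} (coloredOrderLang k).Structure)
    (hM : M ∈ homogeneousColoredOrders k) (N : Bundled.{0} (coloredOrderLang k).Structure)
    (hN : N ∈ homogeneousColoredOrders k) :
    colPattern k M = colPattern k N ↔ Nonempty (M ≃[coloredOrderLang k] N) := by
  obtain ⟨_, hM, hM_hom⟩ := hM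
  obtain ⟨_, hN, hN_hom⟩ := hN
  exact ⟨(hM.isGenericColored hM_hom).nonempty_equiv (hN.isGenericColored hN_hom),
    fun ⟨e⟩ => colPattern_congr e⟩

theorem image_colPattern_homogeneousColoredOrders :
    (fun M : Bundled.{0} (coloredOrderLang k).Structure => colPattern k M) ''
      homogeneousColoredOrders k = {p | p.IsWeakOrder} := by
  ext p
  constructor
  · rintro ⟨M, hM, rfl⟩
    exact hM.2.1.isWeakOrder_colPattern hM.2.2
  · exact fun hp => ⟨_, GenericOrder.mem_homogeneousColoredOrders hp, GenericOrder.colPattern_eq hp⟩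

theorem image_colPattern_homogeneousAllColors :
    (fun M : Bundled.{0} (coloredOrderLang k).Structure => colPattern k M) ''
      homogeneousAllColors k = {p | p.IsWeakOrder ∧ ∀ i, p.used i} := by
  have used_iff (M : Bundled.{0} (coloredOrderLang k).Structure) :
      M ∈ homogeneousAllColors k ↔
        M ∈ homogeneousColoredOrders k ∧ colPattern k M ∈ {p | ∀ i, p.used i} := Iff.rfl
  rw [Set.ofPred_and, ← image_colPattern_homogeneousColoredOrders, ← Set.image_inter_preimage]
  exact congrArg _ (Set.ext used_iff)

theorem finite_isoTypes_homogeneousColoredOrders (k : ℕ) :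
    (isoTypes (homogeneousColoredOrders k)).Finite :=
  finite_isoTypes colPattern_eq_iff_of_mem

theorem numHomogeneous_eq_totalCount (k : ℕ) : numHomogeneous k = ColorPattern.totalCount k := by
  rw [numHomogeneous, ncard_isoTypes colPattern_eq_iff_of_mem,
    image_colPattern_homogeneousColoredOrders, ColorPattern.ncard_setOf_isWeakOrder,
    Fintype.card_fin]

theorem numHomogeneousAll_eq_patternCount (k : ℕ) :
    numHomogeneousAll k = ColorPattern.patternCount k := by
  rw [numHomogeneousAll, ncard_isoTypes fun M hM N hN => colPattern_eq_iff_of_mem M hM.1 N hN.1,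
    image_colPattern_homogeneousAllColors, ColorPattern.ncard_setOf_isWeakOrder_forall_used,
    Fintype.card_fin]

end GenericOrder

theorem mainTheorem7 :
    -- for each `k` there are finitely many isomorphism types, as many as there are
    -- multicolored orderings
    (∀ k : ℕ, (isoTypes (homogeneousColoredOrders k)).Finite ∧
      (isoTypes (multiColoredOrders k)).Finite ∧
      numHomogeneous k = (isoTypes (multiColoredOrders k)).ncard) ∧
    -- the recursion
    (∃ J : ℕ → ℕ, J 0 = 1 ∧
      (∀ k : ℕ, J (k + 1) = 2 * (k + 1) * J k +
        ∑ i ∈ Finset.Icc 2 (k + 1), (k + 1).choose i * J (k + 1 - i)) ∧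
      ∀ k : ℕ, numHomogeneous k = ∑ i ∈ Finset.range (k + 1), J i * k.choose i) ∧
    -- the exponential generating function
    (PowerSeries.mk fun k : ℕ => (numHomogeneous k : ℝ) / (k ! : ℝ)) =
      PowerSeries.exp ℝ * (2 - PowerSeries.X - PowerSeries.exp ℝ)⁻¹ ∧
    -- `R` is the residue at `Z` of the meromorphic function `e^z / (2 - z - e^z)`
    Tendsto (fun z : ℂ => (z - (dominantPole : ℂ)) *
        (Complex.exp z / (2 - z - Complex.exp z)))
      (𝓝[≠] (dominantPole : ℂ)) (𝓝 (poleResidue : ℂ)) ∧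
    -- the asymptotics
    Asymptotics.IsEquivalent atTop (fun k : ℕ => (numHomogeneous k : ℝ))
      (fun k : ℕ => -((k ! : ℝ) * poleResidue * (1 / dominantPole) ^ (k + 1))) ∧
    -- the limiting proportion of those that use all `k` colors
    Tendsto (fun k : ℕ => (numHomogeneousAll k : ℝ) / (numHomogeneous k : ℝ)) atTop
      (𝓝 (1 / lambertW (Real.exp 2))) ∧
    -- the numerical values
    |dominantPole - 0.442854| < 1e-6 ∧ |poleResidue + 0.6089389| < 1e-7 ∧
    |1 / lambertW (Real.exp 2) - 0.6422007| < 1e-7 := by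
  simp only [numHomogeneous_eq_totalCount, numHomogeneousAll_eq_patternCount]
  exact ⟨fun k => ⟨finite_isoTypes_homogeneousColoredOrders k,
      finite_isoTypes_multiColoredOrders k, (ncard_isoTypes_multiColoredOrders k).symm⟩,
    ⟨ColorPattern.patternCount, ColorPattern.patternCount_zero,
      ColorPattern.patternCount_succ_eq_sum_Icc, fun k => rfl⟩,
    ColorPattern.egf_totalCount_eq_exp_mul_inv ℝ, tendsto_poleResidue,
    ColorPattern.isEquivalent_totalCount, ColorPattern.tendsto_patternCount_div_totalCount,
    abs_dominantPole_sub_lt, abs_poleResidue_add_lt, abs_one_div_lambertW_sub_lt⟩
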